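/- Let $n\ge 2$ and $Q=[0,1]^n$, and let $|\cdot|$ be Lebesgue measure. For $k=0,1,2,\dots$ let $\alpha_k=(2^{k+1}-1)^{-1}$. The cubes of generation $k$ are defined recursively: the only cube of generation $0$ is $Q$, and each closed cube of generation $k$ (edge $\alpha_k$, center $c$) contains $2^n$ closed cubes of generation $k+1$, of edge $\alpha_{k+1}$, whose centers are the points $c+\frac{\alpha_k}{4}(\pm1,\dots,\pm1)$. Let $\mathcal Q_k$ be the union of the $2^{nk}$ cubes of generation $k$. Each cube of generation $k$ has a partner of generation $k$, obtained by changing the last sign in all the $k$ choices of signs that lead to it (i.e. by the reflection $x_n\mapsto 1-x_n$). For homeomorphisms of $Q$ onto itself let $d(\Phi,\Psi)=\sup_Q|\Phi-\Psi|+\sup_Q|\Phi^{-1}-\Psi^{-1}|$. A map $f:Q\to\mathbb R$ is approximately differentiable at $x\in Q$, with approximate derivative $L$ ($L:\mathbb R^n\to\mathbb R$ linear), if there is a measurable set $E_x\subset Q$ that has $x$ as a density point and satisfies $\lim_{E_x\ni y\to x}|f(y)-f(x)-L(y-x)|/|y-x|=0$; for maps into $\mathbb R^n$ this is understood componentwise.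 A map has the Lusin property (N) if it maps null sets to null sets. Then there exist a homeomorphism $\Phi$ of $Q$ onto itself and a compact set $A$ in the interior of $Q$ such that 1. $\Phi$ is measure preserving, is approximately differentiable almost everywhere in $Q$, and has the Lusin property (N); 2. $\Phi=\mathrm{id}$ in a neighborhood of $\partial Q$; 3. $|A|=2^{-n}$; 4. $\Phi(x)=(x_1,\dots,x_{n-1},1-x_n)$ for all $x\in A$, $\Phi(A)=A$, and $\Phi$ is a $C^\infty$-diffeomorphism of $Q\setminus A$ onto itself; 5. $\operatorname{ap}D\Phi(x)=\operatorname{diag}(1,\dots,1,-1)$ at almost all points $x\in A$; 6. $A=\bigcap_{k}\mathcal Q_k$, and there are measure preserving $C^\infty$-diffeomorphisms $\Phi_k$ of $Q$ onto itself ($k=0,1,2,\dots$) with $d(\Phi_k,\Phi)\to0$ such that, for every $k$: $\Phi_k=\mathrm{id}$ in a neighborhood of $\partial Q$; in a neighborhood of each cube of generation $k$ (relative to $Q$) $\Phi_k$ is the translation that carries this cube onto its partner; and $\Phi=\Phi_k$ on $Q\setminus\mathcal Q_k$. -/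

import Mathlib

open MeasureTheory Filter Topology Set
open scoped ContDiff

namespace CubeSwap

noncomputable section

/-- The Euclidean space `ℝⁿ`. The last coordinate is the one with index `i`, `i + 1 = n`. -/
abbrev Space (n : ℕ) : Type := EuclideanSpace ℝ (Fin n)

/-- The closed unit cube `Q = [0,1]ⁿ`. -/
def unitCube (n : ℕ) : Set (Space n) := {x | ∀ i, x i ∈ Icc (0 : ℝ) 1}

/-- A self-map of the cube as a map of `ℝⁿ`, extended by the identity. All notions below only use
its values on the cube. -/
def extendMap {n : ℕ} (f : unitCube n → unitCube n) : Space n → Space n :=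
  Function.extend Subtype.val (fun x => (f x : Space n)) id

/-- Lebesgue measure on the cube. -/
def cubeVolume (n : ℕ) : Measure (unitCube n) := Measure.comap Subtype.val volume

/-- `f` is the identity in a neighborhood of the boundary of the cube. -/
def IsIdNearBoundary {n : ℕ} (f : unitCube n → unitCube n) : Prop :=
  ∃ U : Set (Space n), IsOpen U ∧ frontier (unitCube n) ⊆ U ∧
    ∀ x ∈ U ∩ unitCube n, extendMap f x = x

/-- The restriction of the homeomorphism `Φ` of the cube to `S ⊆ Q` is a `C^∞`-diffeomorphism of
`S` onto its image. -/
def IsSmoothDiffeoOn {n : ℕ} (Φ : unitCube n ≃ₜ unitCube n) (S : Set (Space n)) : Prop :=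
  ContDiffOn ℝ ∞ (extendMap Φ) S ∧ ContDiffOn ℝ ∞ (extendMap Φ.symm) (extendMap Φ '' S)

/-- The Lusin property (N): null subsets of the cube are mapped to null sets. -/
def HasLusinN {n : ℕ} (f : unitCube n → unitCube n) : Prop :=
  ∀ N ⊆ unitCube n, volume N = 0 → volume (extendMap f '' N) = 0

/-- The uniform metric on homeomorphisms of the cube. -/
def unifDist {n : ℕ} (Φ Ψ : unitCube n ≃ₜ unitCube n) : ℝ :=
  (⨆ x, dist (Φ x) (Ψ x)) + ⨆ x, dist (Φ.symm x) (Ψ.symm x)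

/-- `x` is a (Lebesgue) density point of `E`. -/
def IsDensityPoint {n : ℕ} (E : Set (Space n)) (x : Space n) : Prop :=
  Tendsto (fun r : ℝ => volume (E ∩ Metric.ball x r) / volume (Metric.ball x r))
    (𝓝[>] 0) (𝓝 1)

/-- The function `f`, considered on `S`, is approximately differentiable at `x ∈ S`, and `L` is its
approximate derivative there. -/
def HasApproxDerivAt {n : ℕ} (f : Space n → ℝ) (S : Set (Space n)) (x : Space n)
    (L : Space n →L[ℝ] ℝ) : Prop :=
  x ∈ S ∧ ∃ E ⊆ S, MeasurableSet E ∧ IsDensityPoint E x ∧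
    Tendsto (fun y => |f y - f x - L (y - x)| / ‖y - x‖) (𝓝[E \ {x}] x) (𝓝 0)

/-- Approximate differentiability of a self-map of the cube at `x ∈ Q`, with approximate derivative
`D`: this is understood component by component. -/
def MapHasApproxDerivAt {n : ℕ} (f : unitCube n → unitCube n) (x : Space n)
    (D : Space n →L[ℝ] Space n) : Prop :=
  ∀ i : Fin n, HasApproxDerivAt (fun y => extendMap f y i) (unitCube n) x
    ((EuclideanSpace.proj i : Space n →L[ℝ] ℝ).comp D)

/-- The diagonal matrix `diag(1, …, 1, -1)`. -/
def reflectionMatrix (n : ℕ) : Matrix (Fin n) (Fin n) ℝ :=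
  Matrix.diagonal fun i => if (i : ℕ) + 1 = n then -1 else 1

/-- The reflection `(x₁, …, xₙ₋₁, xₙ) ↦ (x₁, …, xₙ₋₁, 1 - xₙ)`. -/
def reflection (n : ℕ) (x : Space n) : Space n :=
  WithLp.toLp 2 fun i => if (i : ℕ) + 1 = n then 1 - x i else x i

/-- The edge length `α_k = 1 / (2^(k+1) - 1)` of the cubes of generation `k`. -/
def edge (k : ℕ) : ℝ := ((2 : ℝ) ^ (k + 1) - 1)⁻¹

/-- The cubes of generation `k` are indexed by words of `k` letters, each letter choosing one of
the `2ⁿ` subcubes; `true` means the upper half in the given coordinate. -/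
abbrev Address (n k : ℕ) : Type := Fin k → Fin n → Bool

/-- The center of a cube of generation `k`: inside a cube of generation `l` with center `c`, the
cubes of generation `l + 1` have the centers with coordinates `c i ± α_l / 4`. -/
def cubeCenter {n k : ℕ} (w : Address n k) : Space n :=
  WithLp.toLp 2 fun i => 1 / 2 + ∑ l : Fin k, (if w l i then 1 else -1) * (edge l / 4)

/-- The closed cube of generation `k` with address `w`. -/
def genCube {n k : ℕ} (w : Address n k) : Set (Space n) :=
  {x | ∀ i, |x i - cubeCenter w i| ≤ edge k / 2}

/-- The union of all cubes of generation `k`. -/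
def genUnion (n k : ℕ) : Set (Space n) := ⋃ w : Address n k, genCube w

/-- The address of the cube that is exchanged with the cube of address `w`: lower and upper layers
are interchanged in every generation. -/
def swapAddress {n k : ℕ} (w : Address n k) : Address n k :=
  fun l i => if (i : ℕ) + 1 = n then !(w l i) else w l i

/-- `f` exchanges the cubes of generation `k` rigidly: in a neighborhood of each of them it is the
translation that carries the cube onto its partner. -/
def SwapsRigidly {n : ℕ} (f : unitCube n → unitCube n) (k : ℕ) : Prop :=
  ∀ w : Address n k, ∃ U : Set (Space n), IsOpen U ∧ genCube w ⊆ U ∧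
    ∀ x ∈ U ∩ unitCube n, extendMap f x = x + (cubeCenter (swapAddress w) - cubeCenter w)

end

end CubeSwap

/-! The map is the limit of diffeomorphisms `Ψ k` that carry every cube of generation `k` by
translation onto its partner. They are built recursively: `Ψ (k + 1)` is `Ψ k` preceded by a map `σ
k` that acts inside each cube of generation `k` and exchanges there the lower and upper layers of
subcubes (`exists_exchange`). `Ψ k` treats the first `k` letters of an address, `σ k` the last one.

The exchange has to be smooth, volume preserving and compactly supported. Its elementary piece is a
half-turn in two coordinates inside a box (`exists_boxRotor`). A map of constant Jacobian takes a
rectangle onto the disc, where a twist by an angle depending only on the radius preserves area; the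
angle is `π` on a large disc and zero near the circle. Since the change of coordinates is odd, the
half-turn of the disc becomes an exact half-turn of the rectangle. In the other coordinates the
angle is cut off by a factor; area is preserved for each value of this factor, so Fubini gives
preservation of volume. A half-turn of a column containing two partner subcubes exchanges them, and
half-turns of the single subcubes then restore their orientation, leaving a translation. A second
coordinate is needed for turning, whence `2 ≤ n`.

Consecutive `Ψ k` and their inverses differ by at most the diameter of a cube of generation `k`,
which decays geometrically. So both sequences converge uniformly, to a homeomorphism `Φ` and its
inverse (`exists_limit_homeomorph`), and measure preservation passes to the limit. Off the cubes of
generation `k` the sequence is constant from index `k` on, which gives smoothness off the limit set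
`A`. On a small cube the translation onto the partner is close to the reflection, so `Φ` is the
reflection on `A`; at density points of `A` this determines the approximate derivative. Property (N)
holds because the inverse preserves measure too. -/

namespace CubeSwap

/-! ### Rectangle and disc: a change of coordinates with constant Jacobian -/

open Real

/-- The area of the part `-1 < u < sin t` of the unit disc is `profile t + π / 2`
for `|t| ≤ π / 2`. -/
noncomputable def profile (t : ℝ) : ℝ := t + sin t * cos t

/-- The increment is `(t - s) + sin (t - s) * cos (t + s)`, positive because `|sin u| < u` for `u >
0`. This avoids the zeros of the derivative `2 cos² t`. -/
lemma profile_strictMono : StrictMono profile := by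
  intro s t hst
  have h1 : sin t * cos t - sin s * cos s = sin (t - s) * cos (t + s) := by
    rw [sin_sub, cos_add]
    linear_combination (sin s * cos s) * sin_sq_add_cos_sq t
      - (sin t * cos t) * sin_sq_add_cos_sq s
  have h2 : |sin (t - s)| < t - s := by
    have := abs_sin_lt_abs (x := t - s) (by linarith)
    rwa [abs_of_pos (by linarith : 0 < t - s)] at this
  have h3 : |sin (t - s) * cos (t + s)| ≤ |sin (t - s)| := by
    rw [abs_mul]
    exact mul_le_of_le_one_right (abs_nonneg _) (abs_cos_le_one _)
  have h4 := neg_abs_le (sin (t - s) * cos (t + s))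
  simp only [profile]
  linarith

lemma contDiff_profile : ContDiff ℝ ∞ profile := by
  unfold profile
  exact contDiff_id.add (contDiff_sin.mul contDiff_cos)

lemma hasDerivAt_profile (t : ℝ) : HasDerivAt profile (2 * cos t ^ 2) t := by
  have := (hasDerivAt_id t).add ((hasDerivAt_sin t).mul (hasDerivAt_cos t))
  refine HasDerivAt.congr_deriv this ?_
  linear_combination -sin_sq_add_cos_sq t

lemma abs_profile_sub_le (t : ℝ) : |profile t - t| ≤ 1 := by
  simp only [profile, add_sub_cancel_left, abs_mul]
  exact mul_le_one₀ (abs_sin_le_one t) (abs_nonneg _) (abs_cos_le_one t)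

lemma profile_surjective : Function.Surjective profile := by
  apply contDiff_profile.continuous.surjective
  · refine tendsto_atTop_mono (f := fun t => t - 1) (fun t => ?_)
      (tendsto_atTop_add_const_right _ _ tendsto_id)
    have := abs_le.1 (abs_profile_sub_le t)
    linarith
  · refine tendsto_atBot_mono (g := profile) (f := fun t : ℝ => t + 1) (fun t => ?_)
      (tendsto_atBot_add_const_right _ _ tendsto_id)
    have := abs_le.1 (abs_profile_sub_le t)
    linarith

/-- The order isomorphism of the line given by `profile`. -/
noncomputable def profileIso : ℝ ≃o ℝ :=
  profile_strictMono.orderIsoOfSurjective profile profile_surjective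

/-- The inverse of `profile`. -/
noncomputable def angle (x : ℝ) : ℝ := profileIso.symm x

lemma profile_angle (x : ℝ) : profile (angle x) = x := profileIso.apply_symm_apply x

lemma angle_profile (t : ℝ) : angle (profile t) = t := profileIso.symm_apply_apply t

lemma angle_strictMono : StrictMono angle := profileIso.symm.strictMono

lemma continuous_angle : Continuous angle := profileIso.symm.continuous

lemma angle_neg (x : ℝ) : angle (-x) = -angle x := by
  apply profile_strictMono.injective
  rw [profile_angle]
  conv_lhs => rw [← profile_angle x]
  simp only [profile, sin_neg, cos_neg]
  ring

lemma profile_pi_div_two : profile (π / 2) = π / 2 := by simp [profile]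

lemma angle_pi_div_two : angle (π / 2) = π / 2 := by
  conv_lhs => rw [← profile_pi_div_two]
  exact angle_profile _

lemma abs_angle (x : ℝ) : |angle x| = angle |x| := by
  have h0 : angle 0 = 0 := by
    have := angle_neg 0
    rw [neg_zero] at this
    linarith
  rcases le_total 0 x with h | h
  · rw [abs_of_nonneg h, abs_of_nonneg]
    rw [← h0]
    exact angle_strictMono.monotone h
  · rw [abs_of_nonpos h, abs_of_nonpos, angle_neg]
    rw [← h0]
    exact angle_strictMono.monotone h

lemma abs_angle_lt {x : ℝ} (hx : |x| < π / 2) : |angle x| < π / 2 := by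
  rw [abs_angle]
  conv_rhs => rw [← angle_pi_div_two]
  exact angle_strictMono hx

lemma cos_angle_pos {x : ℝ} (hx : |x| < π / 2) : 0 < cos (angle x) :=
  cos_pos_of_mem_Ioo (abs_lt.1 (abs_angle_lt hx))

lemma hasDerivAt_angle {x : ℝ} (hx : |x| < π / 2) :
    HasDerivAt angle (2 * cos (angle x) ^ 2)⁻¹ x := by
  have := cos_angle_pos hx
  exact HasDerivAt.of_local_left_inverse continuous_angle.continuousAt
    (hasDerivAt_profile _) (by positivity) (Eventually.of_forall profile_angle)

/-- Inverse function theorem. The derivative of `profile` vanishes at `±π / 2`, so the endpoints are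
excluded; for this reason rotors must be trivial near the circle. -/
lemma contDiffAt_angle {x : ℝ} (hx : |x| < π / 2) : ContDiffAt ℝ ∞ angle x := by
  have := cos_angle_pos hx
  exact profileIso.toHomeomorph.toOpenPartialHomeomorph.contDiffAt_symm_deriv
    (f₀' := 2 * cos (angle x) ^ 2) (by positivity) (mem_univ x) (hasDerivAt_profile _)
    contDiff_profile.contDiffAt

/-- The open rectangle with half-edges `a` and `b` centered at the origin. -/
def rect (a b : ℝ) : Set (ℝ × ℝ) := {z | |z.1| < a ∧ |z.2| < b}

lemma isOpen_rect (a b : ℝ) : IsOpen (rect a b) :=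
  (isOpen_lt continuous_fst.abs continuous_const).inter
    (isOpen_lt continuous_snd.abs continuous_const)

/-- A map with constant Jacobian of the rectangle `rect a b` onto the unit disc. -/
noncomputable def toDisc (a b : ℝ) (z : ℝ × ℝ) : ℝ × ℝ :=
  (sin (angle (π / (2 * a) * z.1)), z.2 / b * cos (angle (π / (2 * a) * z.1)))

/-- The inverse of `toDisc`. -/
noncomputable def ofDisc (a b : ℝ) (w : ℝ × ℝ) : ℝ × ℝ :=
  (2 * a / π * profile (arcsin w.1), b * w.2 / √(1 - w.1 ^ 2))

/-- The square of the distance from the origin. -/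
def normSq (w : ℝ × ℝ) : ℝ := w.1 ^ 2 + w.2 ^ 2

section

variable {a b : ℝ}

lemma abs_scale_lt (ha : 0 < a) {x : ℝ} (hx : |x| < a) : |π / (2 * a) * x| < π / 2 := by
  rw [abs_mul, abs_of_pos (by positivity)]
  calc π / (2 * a) * |x| < π / (2 * a) * a := by gcongr
    _ = π / 2 := by field_simp

lemma normSq_toDisc (z : ℝ × ℝ) : normSq (toDisc a b z) =
    1 - cos (angle (π / (2 * a) * z.1)) ^ 2 * (1 - (z.2 / b) ^ 2) := by
  simp only [normSq, toDisc]
  linear_combination sin_sq_add_cos_sq (angle (π / (2 * a) * z.1))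

lemma continuous_toDisc : Continuous (toDisc a b) := by
  have := continuous_angle
  unfold toDisc
  fun_prop

lemma toDisc_neg (z : ℝ × ℝ) : toDisc a b (-z) = -toDisc a b z := by
  simp [toDisc, angle_neg, neg_div]

lemma sq_div_lt_one (hb : 0 < b) {y : ℝ} (hy : |y| < b) : (y / b) ^ 2 < 1 := by
  rw [sq_lt_one_iff_abs_lt_one, abs_div, abs_of_pos hb, div_lt_one hb]
  exact hy

lemma normSq_toDisc_lt (ha : 0 < a) (hb : 0 < b) {z : ℝ × ℝ} (hz : z ∈ rect a b) :
    normSq (toDisc a b z) < 1 := by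
  rw [normSq_toDisc]
  have h1 := cos_angle_pos (abs_scale_lt ha hz.1)
  have h2 := sq_div_lt_one hb hz.2
  have : 0 < cos (angle (π / (2 * a) * z.1)) ^ 2 * (1 - (z.2 / b) ^ 2) := by
    apply mul_pos (by positivity)
    linarith
  linarith

lemma ofDisc_toDisc (ha : 0 < a) (hb : 0 < b) {z : ℝ × ℝ} (hz : z ∈ rect a b) :
    ofDisc a b (toDisc a b z) = z := by
  have h1 := cos_angle_pos (abs_scale_lt ha hz.1)
  have h2 := abs_lt.1 (abs_angle_lt (abs_scale_lt ha hz.1))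
  ext
  · simp only [ofDisc, toDisc]
    rw [arcsin_sin h2.1.le h2.2.le, profile_angle]
    field_simp
  · simp only [ofDisc, toDisc]
    rw [show 1 - sin (angle (π / (2 * a) * z.1)) ^ 2 = cos (angle (π / (2 * a) * z.1)) ^ 2 by
      linear_combination -sin_sq_add_cos_sq (angle (π / (2 * a) * z.1)), sqrt_sq h1.le]
    generalize cos (angle (π / (2 * a) * z.1)) = c at h1
    field_simp

lemma abs_fst_lt_one {w : ℝ × ℝ} (hw : normSq w < 1) : |w.1| < 1 := by
  rw [← sq_lt_one_iff_abs_lt_one]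
  unfold normSq at hw
  nlinarith [sq_nonneg w.2]

lemma toDisc_ofDisc (ha : 0 < a) (hb : 0 < b) {w : ℝ × ℝ} (hw : normSq w < 1) :
    toDisc a b (ofDisc a b w) = w := by
  have h1 := abs_lt.1 (abs_fst_lt_one hw)
  have h2 : 0 < 1 - w.1 ^ 2 := by nlinarith
  have h3 : π / (2 * a) * (2 * a / π * profile (arcsin w.1)) = profile (arcsin w.1) := by
    field_simp
  have h4 : 0 < √(1 - w.1 ^ 2) := sqrt_pos.2 h2
  ext
  · simp only [ofDisc, toDisc]
    rw [h3, angle_profile, sin_arcsin h1.1.le h1.2.le]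
  · simp only [ofDisc, toDisc]
    rw [h3, angle_profile, cos_arcsin]
    field_simp

lemma ofDisc_mem_rect (ha : 0 < a) (hb : 0 < b) {w : ℝ × ℝ} (hw : normSq w < 1) :
    ofDisc a b w ∈ rect a b := by
  have h1 := abs_lt.1 (abs_fst_lt_one hw)
  have h2 : 0 < 1 - w.1 ^ 2 := by nlinarith
  have h4 : 0 < √(1 - w.1 ^ 2) := sqrt_pos.2 h2
  constructor
  · simp only [ofDisc]
    have h5 : |profile (arcsin w.1)| < π / 2 := by
      rw [abs_lt]
      constructor
      · have : profile (-(π / 2)) = -(π / 2) := by simp [profile]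
        rw [← this]
        exact profile_strictMono (neg_pi_div_two_lt_arcsin.2 h1.1)
      · rw [← profile_pi_div_two]
        exact profile_strictMono (arcsin_lt_pi_div_two.2 h1.2)
    rw [abs_mul, abs_of_pos (by positivity)]
    calc 2 * a / π * |profile (arcsin w.1)| < 2 * a / π * (π / 2) := by gcongr
      _ = a := by field_simp
  · simp only [ofDisc]
    rw [abs_div, abs_of_pos h4, div_lt_iff₀ h4, abs_mul, abs_of_pos hb]
    gcongr
    rw [← sqrt_sq_eq_abs]
    apply sqrt_lt_sqrt (sq_nonneg _)
    unfold normSq at hw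
    linarith

lemma contDiffAt_toDisc (ha : 0 < a) {z : ℝ × ℝ} (hz : z ∈ rect a b) :
    ContDiffAt ℝ ∞ (toDisc a b) z := by
  have h1 : ContDiffAt ℝ ∞ (fun z : ℝ × ℝ => angle (π / (2 * a) * z.1)) z :=
    (contDiffAt_angle (abs_scale_lt ha hz.1)).comp z
      (contDiffAt_const.mul contDiffAt_fst)
  exact (contDiff_sin.contDiffAt.comp z h1).prodMk
    ((contDiffAt_snd.div_const b).mul (contDiff_cos.contDiffAt.comp z h1))

lemma contDiffAt_ofDisc {w : ℝ × ℝ} (hw : normSq w < 1) : ContDiffAt ℝ ∞ (ofDisc a b) w := by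
  have h1 := abs_lt.1 (abs_fst_lt_one hw)
  have h2 : 0 < 1 - w.1 ^ 2 := by nlinarith
  have h3 : ContDiffAt ℝ ∞ (fun w : ℝ × ℝ => arcsin w.1) w :=
    (contDiffAt_arcsin h1.1.ne' h1.2.ne).comp w contDiffAt_fst
  have h4 : ContDiffAt ℝ ∞ (fun w : ℝ × ℝ => √(1 - w.1 ^ 2)) w :=
    (contDiffAt_const.sub (contDiffAt_fst.pow 2)).sqrt h2.ne'
  exact (contDiffAt_const.mul (contDiff_profile.contDiffAt.comp w h3)).prodMk
    ((contDiffAt_const.mul contDiffAt_snd).div h4 (sqrt_pos.2 h2).ne')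

end

/-! ### Area preserving twists of the disc, transported to the rectangle -/

/-- The rotation of the plane by the angle `φ`. -/
noncomputable def rotate (φ : ℝ) (w : ℝ × ℝ) : ℝ × ℝ :=
  (w.1 * cos φ - w.2 * sin φ, w.1 * sin φ + w.2 * cos φ)

lemma normSq_rotate (φ : ℝ) (w : ℝ × ℝ) : normSq (rotate φ w) = normSq w := by
  simp only [normSq, rotate]
  linear_combination (w.1 ^ 2 + w.2 ^ 2) * sin_sq_add_cos_sq φ

lemma rotate_neg_rotate (φ : ℝ) (w : ℝ × ℝ) : rotate (-φ) (rotate φ w) = w := by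
  ext
  · simp only [rotate, cos_neg, sin_neg]
    linear_combination w.1 * sin_sq_add_cos_sq φ
  · simp only [rotate, cos_neg, sin_neg]
    linear_combination w.2 * sin_sq_add_cos_sq φ

lemma rotate_zero (w : ℝ × ℝ) : rotate 0 w = w := by simp [rotate]

lemma rotate_pi (w : ℝ × ℝ) : rotate π w = -w := by ext <;> simp [rotate]

lemma contDiff_rotate : ContDiff ℝ ∞ (fun p : ℝ × (ℝ × ℝ) => rotate p.1 p.2) := by
  have hc : ContDiff ℝ ∞ cos := contDiff_cos
  have hs : ContDiff ℝ ∞ sin := contDiff_sin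
  unfold rotate
  fun_prop

lemma det_eq_of_prod (L : ℝ × ℝ →L[ℝ] ℝ × ℝ) :
    L.det = (L (1, 0)).1 * (L (0, 1)).2 - (L (0, 1)).1 * (L (1, 0)).2 := by
  rw [ContinuousLinearMap.det, ← LinearMap.det_toMatrix (Module.Basis.finTwoProd ℝ),
    Matrix.det_fin_two]
  simp [LinearMap.toMatrix_apply]

/-- The planar twist by an angle that depends on the distance from the origin. -/
noncomputable def twist (θ : ℝ → ℝ) (w : ℝ × ℝ) : ℝ × ℝ := rotate (θ (normSq w)) w

lemma contDiff_normSq : ContDiff ℝ ∞ normSq := by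
  unfold normSq
  fun_prop

lemma contDiff_twist {θ : ℝ → ℝ} (hθ : ContDiff ℝ ∞ θ) : ContDiff ℝ ∞ (twist θ) :=
  contDiff_rotate.comp ((hθ.comp contDiff_normSq).prodMk contDiff_id)

/-- In polar coordinates the twist is the shear `(r, φ) ↦ (r, φ + θ (r²))`. The columns of the
Jacobian matrix are computed along the coordinate lines. -/
lemma det_fderiv_twist {θ : ℝ → ℝ} (hθ : ContDiff ℝ ∞ θ) (w : ℝ × ℝ) :
    (fderiv ℝ (twist θ) w).det = 1 := by
  have hd : HasFDerivAt (twist θ) (fderiv ℝ (twist θ) w) w :=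
    ((contDiff_twist hθ).differentiable (by simp) w).hasFDerivAt
  obtain ⟨u, v⟩ := w
  have hθ' : HasDerivAt θ (deriv θ (u ^ 2 + v ^ 2)) (u ^ 2 + v ^ 2) :=
    (hθ.differentiable (by simp) _).hasDerivAt
  set φ := θ (u ^ 2 + v ^ 2) with hφ
  set d := deriv θ (u ^ 2 + v ^ 2) with hd'
  have e1 : HasDerivAt (fun t : ℝ => ((t, v) : ℝ × ℝ)) (1, 0) u :=
    (hasDerivAt_id u).prodMk (hasDerivAt_const u v)
  have e2 : HasDerivAt (fun t : ℝ => ((u, t) : ℝ × ℝ)) (0, 1) v :=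
    (hasDerivAt_const v u).prodMk (hasDerivAt_id v)
  have p1 : HasDerivAt (fun t : ℝ => θ (t ^ 2 + v ^ 2)) (d * (2 * u)) u := by
    have : HasDerivAt (fun t : ℝ => t ^ 2 + v ^ 2) (2 * u) u := by
      simpa using (hasDerivAt_pow 2 u).add_const (v ^ 2)
    exact hθ'.comp u this
  have p2 : HasDerivAt (fun t : ℝ => θ (u ^ 2 + t ^ 2)) (d * (2 * v)) v := by
    have : HasDerivAt (fun t : ℝ => u ^ 2 + t ^ 2) (2 * v) v := by
      simpa using (hasDerivAt_pow 2 v).const_add (u ^ 2)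
    exact hθ'.comp v this
  have q1 := ((((hasDerivAt_id u).mul p1.cos).sub (p1.sin.const_mul v)).prodMk
    (((hasDerivAt_id u).mul p1.sin).add (p1.cos.const_mul v))).unique
    (hd.comp_hasDerivAt u e1)
  have q2 := (((p2.cos.const_mul u).sub ((hasDerivAt_id v).mul p2.sin)).prodMk
    ((p2.sin.const_mul u).add ((hasDerivAt_id v).mul p2.cos))).unique
    (hd.comp_hasDerivAt v e2)
  rw [det_eq_of_prod, ← q1, ← q2]
  simp only [id, ← hφ]
  linear_combination sin_sq_add_cos_sq φ

/-- The matrix is triangular, and the factor `1 / (2 cos²)` from the derivative of `angle` cancels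
the two cosines on the diagonal. This is the purpose of `profile`. -/
lemma det_fderiv_toDisc {a b : ℝ} (ha : 0 < a) {z : ℝ × ℝ} (hz : z ∈ rect a b) :
    (fderiv ℝ (toDisc a b) z).det = π / (4 * a * b) := by
  have hd : HasFDerivAt (toDisc a b) (fderiv ℝ (toDisc a b) z) z :=
    ((contDiffAt_toDisc ha hz).differentiableAt (by simp)).hasFDerivAt
  have hx := abs_scale_lt ha hz.1
  obtain ⟨x, y⟩ := z
  have hc := cos_angle_pos hx
  have e1 : HasDerivAt (fun t : ℝ => ((t, y) : ℝ × ℝ)) (1, 0) x :=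
    (hasDerivAt_id x).prodMk (hasDerivAt_const x y)
  have e2 : HasDerivAt (fun t : ℝ => ((x, t) : ℝ × ℝ)) (0, 1) y :=
    (hasDerivAt_const y x).prodMk (hasDerivAt_id y)
  have p1 : HasDerivAt (fun t : ℝ => angle (π / (2 * a) * t)) _ x :=
    (hasDerivAt_angle hx).comp x ((hasDerivAt_id x).const_mul (π / (2 * a)))
  have q1 := (p1.sin.prodMk (p1.cos.const_mul (y / b))).unique (hd.comp_hasDerivAt x e1)
  have q2 := ((hasDerivAt_const y (sin (angle (π / (2 * a) * x)))).prodMk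
    (((hasDerivAt_id y).div_const b).mul_const (cos (angle (π / (2 * a) * x))))).unique
    (hd.comp_hasDerivAt y e2)
  rw [det_eq_of_prod, ← q1, ← q2]
  simp only at hc ⊢
  generalize cos (angle (π / (2 * a) * x)) = c at hc
  field_simp
  ring

/-- The map that turns the rectangle `rect a b` like a disc of the same area, the angle being
`θ q` on the curve that corresponds to the circle of radius `√q`. -/
noncomputable def rotor (a b : ℝ) (θ : ℝ → ℝ) (z : ℝ × ℝ) : ℝ × ℝ :=
  open Classical in if z ∈ rect a b then ofDisc a b (twist θ (toDisc a b z)) else z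

section

variable {a b : ℝ} {θ : ℝ → ℝ}

lemma normSq_twist (w : ℝ × ℝ) : normSq (twist θ w) = normSq w := normSq_rotate _ _

lemma rotor_of_notMem {z : ℝ × ℝ} (hz : z ∉ rect a b) : rotor a b θ z = z := if_neg hz

lemma rotor_of_mem {z : ℝ × ℝ} (hz : z ∈ rect a b) :
    rotor a b θ z = ofDisc a b (twist θ (toDisc a b z)) := if_pos hz

lemma rotor_mem (ha : 0 < a) (hb : 0 < b) {z : ℝ × ℝ} (hz : z ∈ rect a b) :
    rotor a b θ z ∈ rect a b := by
  rw [rotor_of_mem hz]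
  exact ofDisc_mem_rect ha hb (by rw [normSq_twist]; exact normSq_toDisc_lt ha hb hz)

lemma toDisc_rotor (ha : 0 < a) (hb : 0 < b) {z : ℝ × ℝ} (hz : z ∈ rect a b) :
    toDisc a b (rotor a b θ z) = twist θ (toDisc a b z) := by
  rw [rotor_of_mem hz]
  exact toDisc_ofDisc ha hb (by rw [normSq_twist]; exact normSq_toDisc_lt ha hb hz)

lemma rotor_neg_rotor (ha : 0 < a) (hb : 0 < b) (z : ℝ × ℝ) :
    rotor a b (-θ) (rotor a b θ z) = z := by
  by_cases hz : z ∈ rect a b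
  · rw [rotor_of_mem (rotor_mem ha hb hz), toDisc_rotor ha hb hz]
    rw [twist, normSq_twist, Pi.neg_apply, twist, rotate_neg_rotate, ofDisc_toDisc ha hb hz]
  · rw [rotor_of_notMem hz, rotor_of_notMem hz]

lemma rotor_eq_self (ha : 0 < a) (hb : 0 < b) {z : ℝ × ℝ}
    (hz : θ (normSq (toDisc a b z)) = 0) : rotor a b θ z = z := by
  by_cases h : z ∈ rect a b
  · rw [rotor_of_mem h, twist, hz, rotate_zero, ofDisc_toDisc ha hb h]
  · exact rotor_of_notMem h

/-- `toDisc` is odd, so it intertwines the half-turns of rectangle and disc. Thus a nonlinear change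
of coordinates still yields a rigid motion. -/
lemma rotor_eq_neg (ha : 0 < a) (hb : 0 < b) {z : ℝ × ℝ} (h : z ∈ rect a b)
    (hz : θ (normSq (toDisc a b z)) = π) : rotor a b θ z = -z := by
  have h' : -z ∈ rect a b := by simpa [rect] using h
  rw [rotor_of_mem h, twist, hz, rotate_pi, ← toDisc_neg, ofDisc_toDisc ha hb h']

/-- Off a closed subset of the open rectangle, `toDisc` takes values close to the circle. -/
lemma exists_isClosed_subset_rect (ha : 0 < a) (hb : 0 < b) {q : ℝ} (hq : q < 1) :
    ∃ K : Set (ℝ × ℝ), IsClosed K ∧ K ⊆ rect a b ∧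
      ∀ z ∈ rect a b, z ∉ K → q ≤ normSq (toDisc a b z) := by
  have hN : Continuous fun z => normSq (toDisc a b z) :=
    contDiff_normSq.continuous.comp continuous_toDisc
  refine ⟨{z | |z.1| ≤ a ∧ |z.2| ≤ b ∧ normSq (toDisc a b z) ≤ q}, ?_, ?_, ?_⟩
  · exact (isClosed_le continuous_fst.abs continuous_const).inter
      ((isClosed_le continuous_snd.abs continuous_const).inter (isClosed_le hN continuous_const))
  · rintro ⟨x, y⟩ ⟨h1, h2, h3⟩
    simp only at h1 h2
    rw [normSq_toDisc] at h3
    -- On the sides of the rectangle `normSq (toDisc a b z)` equals `1 > q`, so the closed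
    -- conditions force the open ones.
    refine ⟨lt_of_le_of_ne h1 fun h => ?_, lt_of_le_of_ne h2 fun h => ?_⟩
    · have : cos (angle (π / (2 * a) * x)) = 0 := by
        rw [← cos_abs, abs_angle, abs_mul, h, abs_of_pos (by positivity),
          show π / (2 * a) * a = π / 2 by field_simp, angle_pi_div_two, cos_pi_div_two]
      simp only [this] at h3
      linarith
    · have : (y / b) ^ 2 = 1 := by
        rw [← sq_abs, abs_div, abs_of_pos hb, h, div_self hb.ne', one_pow]
      simp only [this] at h3
      linarith
  · intro z hz hK
    by_contra! h
    exact hK ⟨hz.1.le, hz.2.le, h.le⟩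

/-- The rotor depends smoothly on an amplitude of the angle. -/
lemma contDiff_rotor (ha : 0 < a) (hb : 0 < b) (hθ : ContDiff ℝ ∞ θ) {q : ℝ} (hq : q < 1)
    (hθq : ∀ t, q ≤ t → θ t = 0) :
    ContDiff ℝ ∞ (fun p : ℝ × (ℝ × ℝ) => rotor a b (fun t => p.1 * θ t) p.2) := by
  obtain ⟨K, hK, hKR, hKq⟩ := exists_isClosed_subset_rect ha hb hq
  rw [contDiff_iff_contDiffAt]
  rintro ⟨s, z⟩
  -- On `K` the defining formula is smooth; off the closed set `K` the angle is zero, so the map is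
  -- locally the projection, even across the sides of the rectangle.
  by_cases hz : z ∈ K
  · have hR := hKR hz
    have h1 : ContDiffAt ℝ ∞ (fun p : ℝ × (ℝ × ℝ) => toDisc a b p.2) (s, z) :=
      (contDiffAt_toDisc ha hR).comp (s, z) contDiffAt_snd
    have h2 : ContDiffAt ℝ ∞ (fun p : ℝ × (ℝ × ℝ) =>
        rotate (p.1 * θ (normSq (toDisc a b p.2))) (toDisc a b p.2)) (s, z) :=
      contDiff_rotate.contDiffAt.comp (s, z) ((contDiffAt_fst.mul
        ((hθ.comp contDiff_normSq).contDiffAt.comp (s, z) h1)).prodMk h1)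
    have h3 : ContDiffAt ℝ ∞ (fun p : ℝ × (ℝ × ℝ) => ofDisc a b
        (rotate (p.1 * θ (normSq (toDisc a b p.2))) (toDisc a b p.2))) (s, z) :=
      ContDiffAt.comp (s, z) (contDiffAt_ofDisc (by
        rw [normSq_rotate]; exact normSq_toDisc_lt ha hb hR)) h2
    refine h3.congr_of_eventuallyEq ?_
    filter_upwards [((isOpen_rect a b).preimage continuous_snd).mem_nhds
      (show (s, z) ∈ Prod.snd ⁻¹' rect a b from hR)] with p hp
    rw [rotor_of_mem hp, twist]
  · refine (contDiffAt_snd (𝕜 := ℝ) (E := ℝ) (F := ℝ × ℝ)).congr_of_eventuallyEq ?_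
    filter_upwards [(hK.isOpen_compl.preimage continuous_snd).mem_nhds
      (show (s, z) ∈ Prod.snd ⁻¹' Kᶜ from hz)] with p hp
    by_cases h : p.2 ∈ rect a b
    · exact rotor_eq_self ha hb (by simp [hθq _ (hKq _ h hp)])
    · exact rotor_of_notMem h

/-- Determinants are taken in `toDisc ∘ rotor = twist ∘ toDisc`: the constant Jacobian of `toDisc`
cancels. Outside the open rectangle the rotor is locally the identity. -/
lemma det_fderiv_rotor (ha : 0 < a) (hb : 0 < b) (hθ : ContDiff ℝ ∞ θ) {q : ℝ} (hq : q < 1)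
    (hθq : ∀ t, q ≤ t → θ t = 0) (hdiff : Differentiable ℝ (rotor a b θ)) (z : ℝ × ℝ) :
    (fderiv ℝ (rotor a b θ) z).det = 1 := by
  by_cases hz : z ∈ rect a b
  · have h1 : HasFDerivAt (fun z => toDisc a b (rotor a b θ z))
        ((fderiv ℝ (toDisc a b) (rotor a b θ z)).comp (fderiv ℝ (rotor a b θ) z)) z :=
      (((contDiffAt_toDisc ha (rotor_mem ha hb hz)).differentiableAt
        (by simp)).hasFDerivAt).comp z (hdiff z).hasFDerivAt
    have h2 : HasFDerivAt (fun z => twist θ (toDisc a b z))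
        ((fderiv ℝ (twist θ) (toDisc a b z)).comp (fderiv ℝ (toDisc a b) z)) z :=
      (((contDiff_twist hθ).differentiable (by simp) _).hasFDerivAt).comp z
        ((contDiffAt_toDisc ha hz).differentiableAt (by simp)).hasFDerivAt
    have h3 : (fun z => toDisc a b (rotor a b θ z)) =ᶠ[𝓝 z]
        fun z => twist θ (toDisc a b z) := by
      filter_upwards [(isOpen_rect a b).mem_nhds hz] with y hy
      exact toDisc_rotor ha hb hy
    have h4 := congrArg ContinuousLinearMap.det ((h1.congr_of_eventuallyEq h3.symm).unique h2)
    have hcomp : ∀ L M : ℝ × ℝ →L[ℝ] ℝ × ℝ, (L.comp M).det = L.det * M.det := fun L M => by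
      exact LinearMap.det_comp (L : ℝ × ℝ →ₗ[ℝ] ℝ × ℝ) M
    rw [hcomp, hcomp, det_fderiv_toDisc ha hz, det_fderiv_toDisc ha (rotor_mem ha hb hz),
      det_fderiv_twist hθ, one_mul] at h4
    have : π / (4 * a * b) ≠ 0 := by positivity
    exact mul_left_cancel₀ this (by rw [h4, mul_one])
  · obtain ⟨K, hK, hKR, hKq⟩ := exists_isClosed_subset_rect ha hb hq
    have : rotor a b θ =ᶠ[𝓝 z] id := by
      filter_upwards [hK.isOpen_compl.mem_nhds fun h => hz (hKR h)] with p hp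
      by_cases h : p ∈ rect a b
      · exact rotor_eq_self ha hb (hθq _ (hKq _ h hp))
      · exact rotor_of_notMem h
    rw [this.fderiv_eq, fderiv_id]
    simp [ContinuousLinearMap.det]

lemma measurePreserving_rotor (ha : 0 < a) (hb : 0 < b) (hθ : ContDiff ℝ ∞ θ) {q : ℝ}
    (hq : q < 1) (hθq : ∀ t, q ≤ t → θ t = 0) :
    MeasurePreserving (rotor a b θ) volume volume := by
  have hsmooth : ContDiff ℝ ∞ (rotor a b θ) := by
    have h : ContDiff ℝ ∞ (fun z : ℝ × ℝ => ((1 : ℝ), z)) := contDiff_const.prodMk contDiff_id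
    have := (contDiff_rotor ha hb hθ hq hθq).comp h
    simpa [Function.comp_def] using this
  have hdiff := hsmooth.differentiable (by simp)
  refine ⟨hsmooth.continuous.measurable, ?_⟩
  ext s hs
  rw [Measure.map_apply hsmooth.continuous.measurable hs]
  have hleft : Function.LeftInverse (rotor a b (-θ)) (rotor a b θ) := rotor_neg_rotor ha hb
  have hright : Function.RightInverse (rotor a b (-θ)) (rotor a b θ) := fun z => by
    simpa using rotor_neg_rotor (θ := -θ) ha hb z
  have himg : rotor a b θ '' (rotor a b θ ⁻¹' s) = s :=
    image_preimage_eq s hright.surjective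
  have := lintegral_abs_det_fderiv_eq_addHaar_image volume
    (hsmooth.continuous.measurable hs)
    (fun z _ => (hdiff z).hasFDerivAt.hasFDerivWithinAt) hleft.injective.injOn
  rw [himg] at this
  rw [← this]
  simp [det_fderiv_rotor ha hb hθ hq hθq hdiff]

end

end CubeSwap

/-! ### Volume preserving diffeomorphisms of `ℝⁿ` supported in a box -/

namespace CubeSwap

/-- The volume preserving `C^∞`-diffeomorphisms of `ℝⁿ`. -/
structure IsVolumeDiffeo {n : ℕ} (e : Space n ≃ₜ Space n) : Prop where
  contDiff : ContDiff ℝ ∞ e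
  contDiff_symm : ContDiff ℝ ∞ e.symm
  measurePreserving : MeasurePreserving e volume volume

namespace IsVolumeDiffeo

variable {n : ℕ} {e f : Space n ≃ₜ Space n}

lemma refl : IsVolumeDiffeo (Homeomorph.refl (Space n)) :=
  ⟨contDiff_id, contDiff_id, MeasurePreserving.id _⟩

lemma symm (he : IsVolumeDiffeo e) : IsVolumeDiffeo e.symm :=
  ⟨he.contDiff_symm, he.contDiff,
    MeasurePreserving.symm e.toMeasurableEquiv he.measurePreserving⟩

lemma trans (he : IsVolumeDiffeo e) (hf : IsVolumeDiffeo f) : IsVolumeDiffeo (e.trans f) :=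
  ⟨hf.contDiff.comp he.contDiff, he.contDiff_symm.comp hf.contDiff_symm,
    hf.measurePreserving.comp he.measurePreserving⟩

lemma addRight (c : Space n) : IsVolumeDiffeo (Homeomorph.addRight c) := by
  refine ⟨contDiff_id.add contDiff_const, ?_, measurePreserving_add_right volume c⟩
  have : ((Homeomorph.addRight c).symm : Space n → Space n) = fun x => x + -c := by
    ext1 x
    rfl
  rw [this]
  exact contDiff_id.add contDiff_const

end IsVolumeDiffeo

lemma contDiff_coord {n : ℕ} (l : Fin n) : ContDiff ℝ ∞ (fun x : Space n => x l) :=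
  contDiff_piLp_apply 2

section planeMap

variable {n : ℕ} {i j : Fin n} {P P' : ℝ → ℝ × ℝ → ℝ × ℝ} {χ : Space n → ℝ}

/-- The map that acts in the plane of the coordinates `i` and `j` by the planar map `P s`, where
the parameter is given by `s = χ x`. -/
noncomputable def planeMap (i j : Fin n) (P : ℝ → ℝ × ℝ → ℝ × ℝ) (χ : Space n → ℝ)
    (x : Space n) : Space n :=
  WithLp.toLp 2 (Function.update (Function.update x.ofLp i (P (χ x) (x i, x j)).1) j
    (P (χ x) (x i, x j)).2)

/-- `χ` depends only on the coordinates other than `i` and `j`. -/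
def IsIndep (i j : Fin n) (χ : Space n → ℝ) : Prop :=
  ∀ x y : Space n, (∀ l, l ≠ i → l ≠ j → x l = y l) → χ x = χ y

lemma planeMap_apply (x : Space n) (l : Fin n) : planeMap i j P χ x l =
    if l = j then (P (χ x) (x i, x j)).2 else if l = i then (P (χ x) (x i, x j)).1 else x l := by
  simp only [planeMap, Function.update_apply]

lemma planeMap_apply_fst (hij : i ≠ j) (x : Space n) :
    planeMap i j P χ x i = (P (χ x) (x i, x j)).1 := by simp [planeMap_apply, hij]

lemma planeMap_apply_snd (x : Space n) :
    planeMap i j P χ x j = (P (χ x) (x i, x j)).2 := by simp [planeMap_apply]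

lemma planeMap_apply_of_ne (x : Space n) {l : Fin n} (hi : l ≠ i) (hj : l ≠ j) :
    planeMap i j P χ x l = x l := by simp [planeMap_apply, hi, hj]

lemma contDiff_planeMap (hP : ContDiff ℝ ∞ (fun p : ℝ × (ℝ × ℝ) => P p.1 p.2))
    (hχ : ContDiff ℝ ∞ χ) : ContDiff ℝ ∞ (planeMap i j P χ) := by
  have h : ContDiff ℝ ∞ (fun x : Space n => P (χ x) (x i, x j)) :=
    hP.comp (hχ.prodMk ((contDiff_coord i).prodMk (contDiff_coord j)))
  rw [contDiff_euclidean]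
  intro l
  simp only [planeMap_apply]
  split_ifs
  · exact contDiff_snd.comp h
  · exact contDiff_fst.comp h
  · exact contDiff_coord l

lemma planeMap_planeMap (hij : i ≠ j) (hχ : IsIndep i j χ)
    (hPP' : ∀ s z, P' s (P s z) = z) (x : Space n) :
    planeMap i j P' χ (planeMap i j P χ x) = x := by
  have h1 : χ (planeMap i j P χ x) = χ x :=
    hχ _ _ fun l hi hj => planeMap_apply_of_ne x hi hj
  ext l
  rw [planeMap_apply, h1, planeMap_apply_fst hij, planeMap_apply_snd, Prod.mk.eta, hPP']
  split_ifs with hj hi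
  · rw [hj]
  · rw [hi]
  · exact planeMap_apply_of_ne x hi hj

/-- Fubini: with the coordinates other than `i`, `j` frozen, the parameter `χ x` is constant and the
map is a single area preserving `P s`. The two coordinates are integrated out by `lmarginal`. -/
lemma measurePreserving_planeMap (hij : i ≠ j) (hχ : IsIndep i j χ)
    (hP : ∀ s, MeasurePreserving (P s) volume volume) (hm : Measurable (planeMap i j P χ)) :
    MeasurePreserving (planeMap i j P χ) volume volume := by
  have hof := PiLp.volume_preserving_ofLp (Fin n)
  have hto := PiLp.volume_preserving_toLp (Fin n)
  have key : ∀ f : (Fin n → ℝ) → ENNReal, Measurable f →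
      ∫⁻ x, f (planeMap i j P χ (WithLp.toLp 2 x)).ofLp = ∫⁻ x, f x := by
    intro f hf
    have hm' : Measurable fun x : Fin n → ℝ => f (planeMap i j P χ (WithLp.toLp 2 x)).ofLp :=
      hf.comp (hof.measurable.comp (hm.comp hto.measurable))
    refine lintegral_eq_of_lmarginal_eq (μ := fun _ : Fin n => (volume : Measure ℝ))
      ({i, j} : Finset (Fin n)) hm' hf ?_
    ext1 x
    have hmem : i ∉ ({j} : Finset (Fin n)) := by simpa using hij
    rw [lmarginal_insert _ hm' hmem, lmarginal_insert _ hf hmem]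
    simp only [lmarginal_singleton]
    set s := χ (WithLp.toLp 2 x)
    set u : ℝ × ℝ → ENNReal :=
      fun z => f (Function.update (Function.update x i z.1) j z.2) with hu
    have hum : Measurable u := by
      apply hf.comp
      rw [measurable_pi_iff]
      intro l
      simp only [Function.update_apply]
      split_ifs <;> fun_prop
    have hstep : ∀ y z, f (planeMap i j P χ (WithLp.toLp 2
        (Function.update (Function.update x i y) j z))).ofLp = u (P s (y, z)) := by
      intro y z
      have h1 : χ (WithLp.toLp 2 (Function.update (Function.update x i y) j z)) = s :=
        hχ _ _ fun l hi hj => by simp [hi, hj]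
      rw [planeMap, h1, hu]
      congr 1
      ext l
      simp only [Function.update_apply]
      grind
    simp_rw [hstep]
    calc ∫⁻ y, ∫⁻ z, u (P s (y, z)) = ∫⁻ p, u (P s p) := by
          rw [Measure.volume_eq_prod,
            lintegral_prod (fun p => u (P s p)) (hum.comp (hP s).measurable).aemeasurable]
      _ = ∫⁻ p, u p := (hP s).lintegral_comp hum
      _ = ∫⁻ y, ∫⁻ z, u (y, z) := by
          rw [Measure.volume_eq_prod, lintegral_prod _ hum.aemeasurable]
  refine ⟨hm, ?_⟩
  ext S hS
  rw [Measure.map_apply hm hS, ← hto.measure_preimage (hm hS).nullMeasurableSet,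
    ← hto.measure_preimage hS.nullMeasurableSet,
    ← lintegral_indicator_one (hto.measurable (hm hS)),
    ← lintegral_indicator_one (hto.measurable hS)]
  rw [← key _ (measurable_one.indicator (hto.measurable hS))]
  rfl

end planeMap

/-- A smooth cut-off function of one variable. -/
lemma exists_cutoff {r R : ℝ} (hr : 0 < r) (hrR : r < R) :
    ∃ β : ℝ → ℝ, ContDiff ℝ ∞ β ∧ (∀ t, |t| ≤ r → β t = 1) ∧ ∀ t, R ≤ |t| → β t = 0 := by
  let f : ContDiffBump (0 : ℝ) := ⟨r, R, hr, hrR⟩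
  refine ⟨f, f.contDiff, fun t ht => f.one_of_mem_closedBall ?_, fun t ht => f.zero_of_le_dist ?_⟩
  · simpa [f] using ht
  · simpa [f] using ht

/-- A volume preserving diffeomorphism that is the identity off a box centered at the origin, and
that on a smaller box is the reflection of the two coordinates `i` and `j`. -/
lemma exists_boxRotor_zero {n : ℕ} {i j : Fin n} (hij : i ≠ j) {ρ ρ' : Fin n → ℝ}
    (h0 : ∀ l, 0 < ρ l) (hρ : ∀ l, ρ l < ρ' l) :
    ∃ e : Space n ≃ₜ Space n, IsVolumeDiffeo e ∧
      (∀ x : Space n, (∃ l, ρ' l ≤ |x l|) → e x = x) ∧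
      ∀ x : Space n, (∀ l, |x l| ≤ ρ l) →
        ∀ l, e x l = if l = i ∨ l = j then -x l else x l := by
  set a := ρ' i
  set b := ρ' j
  have ha : 0 < a := (h0 i).trans (hρ i)
  have hb : 0 < b := (h0 j).trans (hρ j)
  -- The inner rectangle is compact in the open one, so it goes into a disc of squared radius `q <
  -- 1`, where the angle will be `π`. The maximum with `1 / 2` only makes `q` positive, as the
  -- cut-off requires.
  obtain ⟨q, hq0, hq1, hq⟩ : ∃ q, 0 < q ∧ q < 1 ∧
      ∀ z : ℝ × ℝ, |z.1| ≤ ρ i → |z.2| ≤ ρ j → normSq (toDisc a b z) ≤ q := by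
    have hN : Continuous fun z => normSq (toDisc a b z) :=
      contDiff_normSq.continuous.comp continuous_toDisc
    have hK : IsCompact (Icc (-ρ i) (ρ i) ×ˢ Icc (-ρ j) (ρ j)) := isCompact_Icc.prod isCompact_Icc
    have hne : (Icc (-ρ i) (ρ i) ×ˢ Icc (-ρ j) (ρ j)).Nonempty :=
      ⟨(0, 0), ⟨by simp [(h0 i).le], by simp [(h0 j).le]⟩⟩
    obtain ⟨z₀, hz₀, hmax⟩ := hK.exists_isMaxOn hne hN.continuousOn
    have hz₀' : z₀ ∈ rect a b :=
      ⟨(abs_le.2 hz₀.1).trans_lt (hρ i), (abs_le.2 hz₀.2).trans_lt (hρ j)⟩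
    have hlt := normSq_toDisc_lt ha hb hz₀'
    refine ⟨max (1 / 2) (normSq (toDisc a b z₀)), by positivity, max_lt (by norm_num) hlt, ?_⟩
    intro z h1 h2
    exact (hmax ⟨abs_le.1 h1, abs_le.1 h2⟩).trans (le_max_right _ _)
  obtain ⟨q', hqq', hq'1⟩ := exists_between hq1
  obtain ⟨β, hβ, hβ1, hβ0⟩ := exists_cutoff hq0 hqq'
  set θ : ℝ → ℝ := fun t => Real.pi * β t with hθdef
  have hθ : ContDiff ℝ ∞ θ := contDiff_const.mul hβ
  have hθ0 : ∀ t, q' ≤ t → θ t = 0 := fun t ht => by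
    rw [hθdef]
    simp only
    rw [hβ0 t (ht.trans (le_abs_self t)), mul_zero]
  choose ψ hψ hψ1 hψ0 using fun l => exists_cutoff (h0 l) (hρ l)
  -- The amplitude does not involve the moving coordinates, so it is invariant under the map, and
  -- the inverse arises by changing its sign.
  set χ : Space n → ℝ := fun x => ∏ l ∈ Finset.univ.filter (fun l => l ≠ i ∧ l ≠ j), ψ l (x l)
  have hχ : ContDiff ℝ ∞ χ := contDiff_prod fun l _ => (hψ l).comp (contDiff_coord l)
  have hχi : IsIndep i j χ := by
    intro x y hxy
    refine Finset.prod_congr rfl fun l hl => ?_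
    rw [Finset.mem_filter] at hl
    rw [hxy l hl.2.1 hl.2.2]
  set P : ℝ → ℝ × ℝ → ℝ × ℝ := fun s => rotor a b (fun t => s * θ t) with hP
  have hPs : ContDiff ℝ ∞ (fun p : ℝ × (ℝ × ℝ) => P p.1 p.2) :=
    contDiff_rotor ha hb hθ hq'1 hθ0
  have hPinv : ∀ s z, P (-s) (P s z) = z := fun s z => by
    have := rotor_neg_rotor (θ := fun t => s * θ t) ha hb z
    have hneg : (fun t => -s * θ t) = -(fun t => s * θ t) := by
      ext t
      simp
    rw [hP]
    simp only
    rw [hneg, this]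
  have hPm : ∀ s, MeasurePreserving (P s) volume volume := fun s =>
    measurePreserving_rotor ha hb (contDiff_const.mul hθ) hq'1 fun t ht => by
      rw [hθ0 t ht, mul_zero]
  have hPs' : ContDiff ℝ ∞ (fun p : ℝ × (ℝ × ℝ) => P (-p.1) p.2) :=
    hPs.comp (contDiff_fst.neg.prodMk contDiff_snd)
  have hF := contDiff_planeMap (i := i) (j := j) hPs hχ
  have hF' := contDiff_planeMap (i := i) (j := j) (P := fun s => P (-s)) hPs' hχ
  let e : Space n ≃ₜ Space n :=
    { toFun := planeMap i j P χ
      invFun := planeMap i j (fun s => P (-s)) χ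
      left_inv := planeMap_planeMap hij hχi hPinv
      right_inv := planeMap_planeMap hij hχi fun s z => by simpa using hPinv (-s) z
      continuous_toFun := hF.continuous
      continuous_invFun := hF'.continuous }
  refine ⟨e, ⟨hF, hF', measurePreserving_planeMap hij hχi hPm hF.continuous.measurable⟩, ?_, ?_⟩
  · rintro x ⟨l, hl⟩
    -- Off the box, either `(x i, x j)` is outside the rectangle or the amplitude is zero.
    have hPx : P (χ x) (x i, x j) = (x i, x j) := by
      by_cases hli : l = i
      · subst hli
        exact rotor_of_notMem fun h => absurd h.1 (not_lt.2 hl)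
      by_cases hlj : l = j
      · subst hlj
        exact rotor_of_notMem fun h => absurd h.2 (not_lt.2 hl)
      have : χ x = 0 := Finset.prod_eq_zero (i := l) (by simp [hli, hlj]) (hψ0 l _ hl)
      rw [this]
      exact rotor_eq_self ha hb (by simp)
    change planeMap i j P χ x = x
    ext l
    rw [planeMap_apply, hPx]
    split_ifs with h1 h2
    · rw [h1]
    · rw [h2]
    · rfl
  · intro x hx l
    have hχ1 : χ x = 1 := Finset.prod_eq_one fun l _ => hψ1 l _ (hx l)
    have hPx : P (χ x) (x i, x j) = -(x i, x j) := by
      rw [hχ1]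
      refine rotor_eq_neg ha hb ⟨(hx i).trans_lt (hρ i), (hx j).trans_lt (hρ j)⟩ ?_
      have h1 := hq (x i, x j) (hx i) (hx j)
      have h2 : 0 ≤ normSq (toDisc a b (x i, x j)) := by unfold normSq; positivity
      simp [hθdef, hβ1 _ (by rwa [abs_of_nonneg h2])]
    change planeMap i j P χ x l = _
    rw [planeMap_apply, hPx]
    by_cases hlj : l = j
    · simp [hlj]
    · by_cases hli : l = i <;> simp [hli, hlj, hij]

/-- A volume preserving diffeomorphism that is the identity off a box with center `c`, and
that on a smaller box is the reflection in `c` of the two coordinates `i` and `j`. -/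
lemma exists_boxRotor {n : ℕ} {i j : Fin n} (hij : i ≠ j) (c : Space n) {ρ ρ' : Fin n → ℝ}
    (h0 : ∀ l, 0 < ρ l) (hρ : ∀ l, ρ l < ρ' l) :
    ∃ e : Space n ≃ₜ Space n, IsVolumeDiffeo e ∧
      (∀ x : Space n, (∃ l, ρ' l ≤ |x l - c l|) → e x = x) ∧
      ∀ x : Space n, (∀ l, |x l - c l| ≤ ρ l) →
        ∀ l, e x l = if l = i ∨ l = j then 2 * c l - x l else x l := by
  obtain ⟨e, he, h1, h2⟩ := exists_boxRotor_zero hij h0 hρ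
  refine ⟨((Homeomorph.addRight (-c)).trans e).trans (Homeomorph.addRight c),
    ((IsVolumeDiffeo.addRight _).trans he).trans (IsVolumeDiffeo.addRight _), ?_, ?_⟩
  · rintro x ⟨l, hl⟩
    simp only [Homeomorph.trans_apply, Homeomorph.coe_addRight]
    rw [h1 _ ⟨l, by simpa [sub_eq_add_neg] using hl⟩]
    abel
  · intro x hx l
    simp only [Homeomorph.trans_apply, Homeomorph.coe_addRight]
    rw [PiLp.add_apply, h2 _ (fun l => by simpa [sub_eq_add_neg] using hx l)]
    simp only [PiLp.add_apply, PiLp.neg_apply]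
    split_ifs <;> ring

end CubeSwap

/-! ### Gluing, the combinatorics of the cubes, and the exchange of layers -/

namespace CubeSwap

variable {n k : ℕ}

/-- Volume preserving diffeomorphisms that move only points of disjoint sets can be glued. -/
lemma exists_glue {ι : Type*} (s : Finset ι) (U : ι → Set (Space n))
    (hU : (s : Set ι).PairwiseDisjoint U) (e : ι → (Space n ≃ₜ Space n))
    (he : ∀ i ∈ s, IsVolumeDiffeo (e i)) (hid : ∀ i ∈ s, ∀ x ∉ U i, e i x = x) :
    ∃ f : Space n ≃ₜ Space n, IsVolumeDiffeo f ∧ (∀ i ∈ s, ∀ x ∈ U i, f x = e i x) ∧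
      ∀ x, (∀ i ∈ s, x ∉ U i) → f x = x := by
  classical
  induction s using Finset.induction with
  | empty => exact ⟨Homeomorph.refl _, .refl, by simp, fun _ _ => rfl⟩
  | insert a s ha ih =>
    obtain ⟨f, hf, hf1, hf2⟩ := ih (hU.subset (by simp))
      (fun i hi => he i (Finset.mem_insert_of_mem hi))
      (fun i hi => hid i (Finset.mem_insert_of_mem hi))
    have hida := hid a (Finset.mem_insert_self a s)
    have hdisj : ∀ i ∈ s, ∀ x ∈ U i, x ∉ U a := fun i hi x hx hxa => by
      have hne : i ≠ a := fun h => ha (h ▸ hi)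
      exact (disjoint_left.1 (hU (by simp [hi]) (by simp) hne) hx) hxa
    have hmem : ∀ x ∈ U a, e a x ∈ U a := fun x hx => by
      by_contra h
      have := (e a).injective (hida _ h)
      exact h (by rwa [this])
    refine ⟨(e a).trans f, (he a (Finset.mem_insert_self a s)).trans hf, ?_, ?_⟩
    · intro i hi x hx
      rw [Homeomorph.trans_apply]
      rcases Finset.mem_insert.1 hi with rfl | hi
      · exact hf2 _ fun l hl h => hdisj l hl _ h (hmem x hx)
      · rw [hida x (hdisj i hi x hx)]
        exact hf1 i hi x hx
    · intro x hx
      rw [Homeomorph.trans_apply, hida x (hx a (Finset.mem_insert_self a s))]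
      exact hf2 x fun i hi => hx i (Finset.mem_insert_of_mem hi)

/-! ### The cubes -/

lemma edge_zero : edge 0 = 1 := by norm_num [edge]

lemma two_pow_sub_one_pos (k : ℕ) : (0 : ℝ) < 2 ^ (k + 1) - 1 := by
  have : (1 : ℝ) < 2 ^ (k + 1) := one_lt_pow₀ (by norm_num) (by simp)
  linarith

lemma edge_pos (k : ℕ) : 0 < edge k := inv_pos.2 (two_pow_sub_one_pos k)

lemma two_mul_edge_succ_lt (k : ℕ) : 2 * edge (k + 1) < edge k := by
  have h1 := two_pow_sub_one_pos k
  have h2 := two_pow_sub_one_pos (k + 1)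
  rw [edge, edge, ← div_eq_mul_inv, inv_eq_one_div, div_lt_div_iff₀ h2 h1]
  rw [pow_succ (2 : ℝ) (k + 1)]
  linarith

lemma edge_le (k : ℕ) : edge k ≤ 1 / 2 ^ k := by
  rw [edge, ← one_div]
  have : (1 : ℝ) ≤ 2 ^ k := one_le_pow₀ (by norm_num)
  apply one_div_le_one_div_of_le (by positivity)
  rw [pow_succ]
  linarith

/-- The address of the cube of the previous generation that contains a given cube. -/
def parent (u : Address n (k + 1)) : Address n k := fun l => u l.castSucc

lemma cubeCenter_apply (w : Address n k) (i : Fin n) :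
    cubeCenter w i = 1 / 2 + ∑ l : Fin k, (if w l i then 1 else -1) * (edge l / 4) := rfl

lemma cubeCenter_succ (u : Address n (k + 1)) (i : Fin n) :
    cubeCenter u i =
      cubeCenter (parent u) i + (if u (Fin.last k) i then 1 else -1) * (edge k / 4) := by
  rw [cubeCenter_apply, cubeCenter_apply, Fin.sum_univ_castSucc, ← add_assoc]
  rfl

lemma abs_cubeCenter_succ_sub (u : Address n (k + 1)) (i : Fin n) :
    |cubeCenter u i - cubeCenter (parent u) i| = edge k / 4 := by
  rw [cubeCenter_succ, add_sub_cancel_left, abs_mul, abs_of_pos (a := edge k / 4)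
    (by have := edge_pos k; positivity)]
  split_ifs <;> simp

/-- Induction on the generation. If the parents already differ in coordinate `i`, their distance
`edge k / 2 > edge (k + 1)` loses at most two shifts of `edge (k + 1) / 4`; otherwise only the last
letters differ and the distance is exact. Since `2 * edge (k + 1) < edge k`, distinct cubes of one
generation are disjoint. -/
lemma le_abs_cubeCenter_sub (u v : Address n (k + 1)) {i : Fin n} (h : ∃ l, u l i ≠ v l i) :
    edge k / 2 ≤ |cubeCenter u i - cubeCenter v i| := by
  induction k with
  | zero =>
    obtain ⟨l, hl⟩ := h
    have hl0 : l = Fin.last 0 := Fin.ext (by simp)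
    subst hl0
    rw [cubeCenter_succ u, cubeCenter_succ v, Subsingleton.elim (parent u) (parent v)]
    cases hu : u (Fin.last 0) i <;> cases hv : v (Fin.last 0) i <;> simp_all [edge_zero] <;>
      norm_num [abs_of_pos, abs_of_neg]
  | succ k ih =>
    have hpos := edge_pos (k + 1)
    have hlt := two_mul_edge_succ_lt k
    by_cases hp : ∃ l, parent u l i ≠ parent v l i
    · have h1 := ih (parent u) (parent v) hp
      have h2 := abs_cubeCenter_succ_sub u i
      have h3 := abs_cubeCenter_succ_sub v i
      have h4 := abs_sub_abs_le_abs_sub (cubeCenter (parent u) i - cubeCenter (parent v) i)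
        (cubeCenter u i - cubeCenter v i)
      have h5 : |cubeCenter (parent u) i - cubeCenter (parent v) i
          - (cubeCenter u i - cubeCenter v i)| ≤ edge (k + 1) / 4 + edge (k + 1) / 4 := by
        rw [← h2]
        nth_rw 2 [h2]
        rw [← h3, ← abs_neg (cubeCenter u i - _)]
        refine le_trans (le_of_eq ?_) (abs_add_le _ _)
        congr 1
        ring
      linarith
    · push Not at hp
      obtain ⟨l, hl⟩ := h
      have hlast : u (Fin.last (k + 1)) i ≠ v (Fin.last (k + 1)) i := by
        rcases Fin.eq_castSucc_or_eq_last l with ⟨l', rfl⟩ | rfl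
        · exact absurd (hp l') hl
        · exact hl
      have heq : cubeCenter (parent u) i = cubeCenter (parent v) i := by
        rw [cubeCenter_apply, cubeCenter_apply]
        simp only [hp]
      rw [cubeCenter_succ u, cubeCenter_succ v, heq]
      cases hu : u (Fin.last (k + 1)) i <;> cases hv : v (Fin.last (k + 1)) i <;>
        simp_all only [ne_eq, not_true_eq_false, Bool.false_eq_true, if_false, if_true,
          not_false_eq_true, reduceCtorEq]
      · rw [abs_of_neg (by linarith)]
        linarith
      · rw [abs_of_pos (by linarith)]
        linarith

lemma abs_cubeCenter_sub_half_le (w : Address n k) (i : Fin n) :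
    |cubeCenter w i - 1 / 2| ≤ 1 / 2 - edge k / 2 := by
  induction k with
  | zero => simp [cubeCenter_apply, edge_zero]
  | succ k ih =>
    have h1 := ih (parent w)
    have h2 := abs_cubeCenter_succ_sub w i
    have h3 := two_mul_edge_succ_lt k
    have h4 := abs_sub_le (cubeCenter w i) (cubeCenter (parent w) i) (1 / 2)
    linarith

lemma genCube_subset_parent (u : Address n (k + 1)) : genCube u ⊆ genCube (parent u) := by
  intro x hx l
  have h1 := hx l
  have h2 := abs_cubeCenter_succ_sub u l
  have h3 := two_mul_edge_succ_lt k
  have h4 := abs_sub_le (x l) (cubeCenter u l) (cubeCenter (parent u) l)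
  linarith

lemma genUnion_antitone : Antitone (genUnion n) := by
  refine antitone_nat_of_succ_le fun k => ?_
  refine iUnion_subset fun u => ?_
  exact (genCube_subset_parent u).trans (subset_iUnion _ _)

lemma eq_of_mem_genCube {v w : Address n k} {x : Space n} (hv : x ∈ genCube v)
    (hw : x ∈ genCube w) : v = w := by
  cases k with
  | zero => exact Subsingleton.elim _ _
  | succ k =>
    funext l i
    by_contra h
    have h1 := le_abs_cubeCenter_sub v w ⟨l, h⟩
    have h2 := hv i
    have h3 := hw i
    have h4 := abs_sub_le (cubeCenter v i) (x i) (cubeCenter w i)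
    rw [abs_sub_comm (cubeCenter v i) (x i)] at h4
    have h5 := two_mul_edge_succ_lt k
    have h6 := edge_pos (k + 1)
    linarith

lemma isClosed_genCube (w : Address n k) : IsClosed (genCube w) := by
  have : genCube w = ⋂ i, {x : Space n | |x i - cubeCenter w i| ≤ edge k / 2} := by
    ext x
    simp [genCube]
  rw [this]
  exact isClosed_iInter fun i => isClosed_le
    ((contDiff_coord i).continuous.sub continuous_const).abs continuous_const

lemma isClosed_genUnion (n k : ℕ) : IsClosed (genUnion n k) :=
  isClosed_iUnion_of_finite isClosed_genCube

lemma dist_le_of_coord {x y : Space n} {t : ℝ} (h : ∀ l, |x l - y l| ≤ t) :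
    dist x y ≤ √n * t := by
  rcases Nat.eq_zero_or_pos n with rfl | hn
  · have : x = y := Subsingleton.elim _ _
    simp [this]
  have ht : 0 ≤ t := (abs_nonneg _).trans (h ⟨0, hn⟩)
  rw [EuclideanSpace.dist_eq]
  calc √(∑ i, dist (x i) (y i) ^ 2) ≤ √(∑ _i : Fin n, t ^ 2) := by
        gcongr with i
        rw [Real.dist_eq]
        exact h i
    _ = √n * t := by simp [Real.sqrt_sq ht]

lemma dist_le_of_mem_genCube {w : Address n k} {x y : Space n} (hx : x ∈ genCube w)
    (hy : y ∈ genCube w) : dist x y ≤ √n * edge k := by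
  refine dist_le_of_coord fun l => ?_
  have h1 := hx l
  have h2 := hy l
  have h3 := abs_sub_le (x l) (cubeCenter w l) (y l)
  rw [abs_sub_comm (cubeCenter w l) (y l)] at h3
  linarith

lemma cubeCenter_swapAddress (w : Address n k) (i : Fin n) :
    cubeCenter (swapAddress w) i =
      if (i : ℕ) + 1 = n then 1 - cubeCenter w i else cubeCenter w i := by
  simp only [cubeCenter_apply, swapAddress]
  split_ifs with h
  · have : ∀ l : Fin k, (if (!(w l i)) = true then (1 : ℝ) else -1) * (edge l / 4)
        = -((if w l i = true then 1 else -1) * (edge l / 4)) := fun l => by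
      cases w l i <;> simp
    simp_rw [this]
    rw [Finset.sum_neg_distrib]
    ring
  · rfl

/-! ### One generation -/

/-- A map that permutes the points of every cube of generation `k`. -/
structure MovesCubes (k : ℕ) (σ : Space n ≃ₜ Space n) : Prop where
  mem : ∀ w : Address n k, ∀ x ∈ genCube w, σ x ∈ genCube w
  eq_self : ∀ x ∉ genUnion n k, σ x = x

namespace MovesCubes

variable {σ τ : Space n ≃ₜ Space n}

lemma trans (hσ : MovesCubes k σ) (hτ : MovesCubes k τ) : MovesCubes k (σ.trans τ) :=
  ⟨fun w x hx => hτ.mem w _ (hσ.mem w x hx), fun x hx => by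
    rw [Homeomorph.trans_apply, hσ.eq_self x hx, hτ.eq_self x hx]⟩

lemma symm (hσ : MovesCubes k σ) : MovesCubes k σ.symm := by
  have h : ∀ x ∉ genUnion n k, σ.symm x = x := fun x hx => by
    rw [Homeomorph.symm_apply_eq, hσ.eq_self x hx]
  refine ⟨fun w y hy => ?_, h⟩
  by_cases hx : σ.symm y ∈ genUnion n k
  · obtain ⟨v, hv⟩ := mem_iUnion.1 hx
    have := hσ.mem v _ hv
    rw [σ.apply_symm_apply] at this
    rwa [eq_of_mem_genCube hy this]
  · have := hσ.eq_self _ hx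
    rw [σ.apply_symm_apply] at this
    rwa [← this]

/-- A homeomorphism that moves only points of sets contained in cubes, the sets being invariant. -/
lemma of_sets {ι : Type*} {s : Finset ι} {U : ι → Set (Space n)} {p : ι → Address n k}
    (hU : ∀ i ∈ s, U i ⊆ genCube (p i)) (hmem : ∀ i ∈ s, ∀ x ∈ U i, σ x ∈ U i)
    (hid : ∀ x, (∀ i ∈ s, x ∉ U i) → σ x = x) : MovesCubes k σ := by
  constructor
  · intro w x hx
    by_cases h : ∀ i ∈ s, x ∉ U i
    · rwa [hid x h]
    · push Not at h
      obtain ⟨i, hi, hxi⟩ := h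
      rw [eq_of_mem_genCube hx (hU i hi hxi)]
      exact hU i hi (hmem i hi x hxi)
  · intro x hx
    exact hid x fun i hi h => hx (mem_iUnion.2 ⟨_, hU i hi h⟩)

lemma dist_le (hσ : MovesCubes k σ) (x : Space n) : dist (σ x) x ≤ √n * edge k := by
  by_cases hx : x ∈ genUnion n k
  · obtain ⟨w, hw⟩ := mem_iUnion.1 hx
    exact dist_le_of_mem_genCube (hσ.mem w x hw) hw
  · rw [hσ.eq_self x hx, dist_self]
    have := edge_pos k
    positivity

end MovesCubes

/-- Simultaneous reflections of the coordinates `i` and `j` in disjoint boxes, each of them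
contained in a cube of generation `k`. -/
lemma exists_boxRotors {i j : Fin n} (hij : i ≠ j) {ι : Type*} (s : Finset ι)
    (c : ι → Space n) (p : ι → Address n k) {ρ ρ' : Fin n → ℝ} {m : ℝ}
    (h0 : ∀ l, 0 < ρ l) (hρ : ∀ l, ρ l < ρ' l) (hm : m ≤ edge k / 2)
    (hp : ∀ a ∈ s, ∀ l, |c a l - cubeCenter (p a) l| + ρ' l ≤ m)
    (hsep : ∀ a ∈ s, ∀ b ∈ s, a ≠ b → ∃ l, 2 * ρ' l ≤ |c a l - c b l|) :
    ∃ σ : Space n ≃ₜ Space n, IsVolumeDiffeo σ ∧ MovesCubes k σ ∧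
      (∀ x, (∀ w : Address n k, ∃ l, m ≤ |x l - cubeCenter w l|) → σ x = x) ∧
      ∀ a ∈ s, ∀ x, (∀ l, |x l - c a l| ≤ ρ l) →
        ∀ l, σ x l = if l = i ∨ l = j then 2 * c a l - x l else x l := by
  choose e he h1 h2 using fun a => exists_boxRotor hij (c a) h0 hρ
  set U : ι → Set (Space n) := fun a => {x | ∀ l, |x l - c a l| < ρ' l} with hUdef
  have hid : ∀ a, ∀ x ∉ U a, e a x = x := by
    intro a x hx
    simp only [hUdef, mem_ofPred_eq] at hx
    push Not at hx
    exact h1 a x hx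
  have hdisj : (s : Set ι).PairwiseDisjoint U := by
    intro a ha b hb hab
    refine disjoint_left.2 fun x hxa hxb => ?_
    obtain ⟨l, hl⟩ := hsep a ha b hb hab
    have e1 := hxa l
    have e2 := hxb l
    have e3 := abs_sub_le (c a l) (x l) (c b l)
    rw [abs_sub_comm (c a l) (x l)] at e3
    linarith
  obtain ⟨σ, hσ, hσ1, hσ2⟩ := exists_glue s U hdisj e (fun a _ => he a) (fun a _ => hid a)
  have hU : ∀ a ∈ s, ∀ x ∈ U a, ∀ l, |x l - cubeCenter (p a) l| < m := by
    intro a ha x hx l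
    have e1 := hx l
    have e2 := hp a ha l
    have e3 := abs_sub_le (x l) (c a l) (cubeCenter (p a) l)
    linarith
  refine ⟨σ, hσ, ?_, ?_, ?_⟩
  · refine MovesCubes.of_sets (s := s) (U := U) (p := p) ?_ ?_ hσ2
    · intro a ha x hx l
      exact ((hU a ha x hx l).le).trans hm
    · intro a ha x hx
      rw [hσ1 a ha x hx]
      by_contra h
      have := (e a).injective (hid a _ h)
      exact h (by rwa [this])
  · intro x hx
    refine hσ2 x fun a ha hxa => ?_
    obtain ⟨l, hl⟩ := hx (p a)
    exact absurd (hU a ha x hxa l) (not_lt.2 hl)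
  · intro a ha x hx l
    rw [hσ1 a ha x fun l => (hx l).trans_lt (hρ l)]
    exact h2 a x hx l

/-- The address of the cube that is exchanged with the cube of address `u` inside their common
parent: only the last letter is changed. -/
def flipLast (u : Address n (k + 1)) : Address n (k + 1) :=
  Function.update u (Fin.last k)
    (fun i => if (i : ℕ) + 1 = n then !(u (Fin.last k) i) else u (Fin.last k) i)

lemma parent_flipLast (u : Address n (k + 1)) : parent (flipLast u) = parent u := by
  ext l i
  simp [parent, flipLast, Fin.castSucc_ne_last]

lemma cubeCenter_flipLast (u : Address n (k + 1)) (i : Fin n) :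
    cubeCenter (flipLast u) i = if (i : ℕ) + 1 = n then
      2 * cubeCenter (parent u) i - cubeCenter u i else cubeCenter u i := by
  rw [cubeCenter_succ (flipLast u), parent_flipLast, cubeCenter_succ u]
  simp only [flipLast, Function.update_self]
  by_cases h : (i : ℕ) + 1 = n
  · cases hu : u (Fin.last k) i <;> simp [h] <;> ring
  · simp [h]

/-- The exchange of the lower and upper layers of cubes of generation `k + 1` inside every cube of
generation `k`. -/
lemma exists_exchange {i j : Fin n} (hij : i ≠ j) (hj : (j : ℕ) + 1 = n) (k : ℕ) :
    ∃ σ : Space n ≃ₜ Space n, IsVolumeDiffeo σ ∧ MovesCubes k σ ∧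
      (∃ m < edge k / 2, ∀ x, (∀ w : Address n k, ∃ l, m ≤ |x l - cubeCenter w l|) → σ x = x) ∧
      ∃ m, edge (k + 1) / 2 < m ∧ m ≤ edge k / 4 ∧ ∀ u : Address n (k + 1), ∀ x : Space n,
        (∀ l, |x l - cubeCenter u l| ≤ m) →
        σ x = x + (cubeCenter (flipLast u) - cubeCenter u) := by
  have hpos := edge_pos k
  have hpos' := edge_pos (k + 1)
  have hlt := two_mul_edge_succ_lt k
  have hjl : ∀ l : Fin n, (l : ℕ) + 1 = n ↔ l = j := fun l => by
    rw [Fin.ext_iff]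
    omega
  -- The gaps between subcubes give the room: `m₁ > edge (k + 1) / 2` makes the motion rigid around
  -- each subcube, and `m₂ < edge k / 4` keeps the supports disjoint and off the boundary of the
  -- parent.
  obtain ⟨m₁, hm₁, hm₁'⟩ := exists_between (show edge (k + 1) / 2 < edge k / 4 by linarith)
  obtain ⟨m₂, hm₂, hm₂'⟩ := exists_between hm₁'
  -- One box for each column of two partner subcubes, represented by the upper one. In coordinate
  -- `j` it is centered at the center of the parent, hence its half-edge `edge k / 4 + m₂` there.
  set s : Finset (Address n (k + 1)) := Finset.univ.filter fun u => u (Fin.last k) j = true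
  set col : Address n (k + 1) → Space n := fun u =>
    WithLp.toLp 2 fun l => if l = j then cubeCenter (parent u) l else cubeCenter u l with hcol
  have hcola : ∀ u l, col u l = if l = j then cubeCenter (parent u) l else cubeCenter u l :=
    fun u l => rfl
  obtain ⟨σ, hσ, hσc, hσm, hσx⟩ := exists_boxRotors hij s col parent
    (ρ := fun l => if l = j then edge k / 4 + m₁ else m₁)
    (ρ' := fun l => if l = j then edge k / 4 + m₂ else m₂) (m := edge k / 4 + m₂)
    (fun l => by split_ifs <;> linarith) (fun l => by split_ifs <;> linarith) (by linarith)
    (fun u _ l => by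
      rw [hcola]
      split_ifs
      · simp
      · rw [abs_cubeCenter_succ_sub])
    (fun u hu v hv huv => by
      by_cases h : ∃ l, l ≠ j ∧ ∃ r, u r l ≠ v r l
      · obtain ⟨l, hl, hr⟩ := h
        refine ⟨l, ?_⟩
        have := le_abs_cubeCenter_sub u v hr
        rw [hcola, hcola, if_neg hl, if_neg hl, if_neg hl]
        linarith
      · push Not at h
        refine ⟨j, ?_⟩
        rw [hcola, hcola, if_pos rfl, if_pos rfl, if_pos rfl]
        have hu1 : u (Fin.last k) j = true := (Finset.mem_filter.1 hu).2
        have hv1 : v (Fin.last k) j = true := (Finset.mem_filter.1 hv).2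
        have hex : ∃ r, parent u r j ≠ parent v r j := by
          by_contra! hno
          apply huv
          ext r l
          by_cases hl : l = j
          · subst hl
            rcases Fin.eq_castSucc_or_eq_last r with ⟨r', rfl⟩ | rfl
            · have := hno r'
              simp only [parent] at this
              rw [this]
            · rw [hu1, hv1]
          · rw [h l hl r]
        -- For `k = 0` there is one parent, so distinct columns already differ in another
        -- coordinate.
        cases k with
        | zero =>
          obtain ⟨r, _⟩ := hex
          exact r.elim0
        | succ k =>
          have := le_abs_cubeCenter_sub (parent u) (parent v) hex
          have := two_mul_edge_succ_lt k
          linarith)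
  -- The half-turn of a column also reflects its subcubes in the coordinates `i` and `j`. A
  -- half-turn of each subcube about its own center undoes this.
  obtain ⟨τ, hτ, hτc, hτm, hτx⟩ := exists_boxRotors hij (Finset.univ : Finset (Address n (k + 1)))
    cubeCenter parent (ρ := fun _ => m₁) (ρ' := fun _ => m₂) (m := edge k / 4 + m₂)
    (fun l => by linarith) (fun l => hm₂) (by linarith)
    (fun u _ l => by rw [abs_cubeCenter_succ_sub])
    (fun u _ v _ huv => by
      have hex : ∃ l r, u r l ≠ v r l := by
        by_contra! hno
        apply huv
        ext r l
        rw [hno l r]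
      obtain ⟨l, hr⟩ := hex
      have := le_abs_cubeCenter_sub u v hr
      exact ⟨l, by linarith⟩)
  have hσu : ∀ u : Address n (k + 1), ∀ x : Space n, (∀ l, |x l - cubeCenter u l| ≤ m₁) →
      ∀ l, σ x l = if l = i then 2 * cubeCenter u l - x l
        else if l = j then 2 * cubeCenter (parent u) l - x l else x l := by
    intro u x hx l
    obtain ⟨v, hvs, hvp, hvl⟩ : ∃ v ∈ s, parent v = parent u ∧
        ∀ l, l ≠ j → cubeCenter v l = cubeCenter u l := by
      by_cases hu : u (Fin.last k) j = true
      · exact ⟨u, by simp [s, hu], rfl, fun _ _ => rfl⟩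
      · refine ⟨flipLast u, by simp [s, flipLast, hj, hu], parent_flipLast u, fun l hl => ?_⟩
        rw [cubeCenter_flipLast, if_neg (by rwa [hjl])]
    rw [hσx v hvs x (fun l => ?_) l]
    · rw [hcola, hvp]
      by_cases hli : l = i
      · have hlj : l ≠ j := fun h => hij (hli.symm.trans h)
        simp [hli, hij, hvl i hij]
      · by_cases hlj : l = j <;> simp [hli, hlj, hij.symm]
    · rw [hcola]
      split_ifs with hlj
      · rw [hvp]
        have e1 := hx l
        have e2 := abs_cubeCenter_succ_sub u l
        have e3 := abs_sub_le (x l) (cubeCenter u l) (cubeCenter (parent u) l)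
        linarith
      · rw [hvl l hlj]
        exact hx l
  refine ⟨σ.trans τ, hσ.trans hτ, hσc.trans hτc, ⟨edge k / 4 + m₂, by linarith, fun x hx => ?_⟩,
    m₁, hm₁, hm₁'.le, fun u x hx => ?_⟩
  · rw [Homeomorph.trans_apply, hσm x hx, hτm x hx]
  · have key := hσu u x hx
    have hnear : ∀ l, |σ x l - cubeCenter (flipLast u) l| ≤ m₁ := by
      intro l
      rw [key, cubeCenter_flipLast]
      simp only [hjl]
      have e1 := hx l
      by_cases hli : l = i
      · have hlj : l ≠ j := fun h => hij (hli.symm.trans h)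
        rw [if_pos hli, if_neg hlj, ← abs_neg]
        refine le_trans (le_of_eq ?_) e1
        congr 1
        ring
      · by_cases hlj : l = j
        · rw [if_neg hli, if_pos hlj, if_pos hlj, ← abs_neg]
          refine le_trans (le_of_eq ?_) e1
          congr 1
          ring
        · rw [if_neg hli, if_neg hlj, if_neg hlj]
          exact e1
    ext l
    rw [Homeomorph.trans_apply, hτx (flipLast u) (Finset.mem_univ _) _ hnear l, key,
      PiLp.add_apply, PiLp.sub_apply, cubeCenter_flipLast]
    simp only [hjl]
    by_cases hli : l = i
    · have hlj : l ≠ j := fun h => hij (hli.symm.trans h)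
      simp only [hli, hij, true_or, if_true, if_false]
      ring
    · by_cases hlj : l = j
      · simp only [hlj, hij.symm, or_true, if_true, if_false]
        ring
      · simp only [hli, hlj, or_self, if_false]
        ring

end CubeSwap

/-! ### Limits of homeomorphisms and the approximating sequence -/

namespace CubeSwap

variable {n k : ℕ}

/-- Rapidly converging homeomorphisms with rapidly converging inverses have a homeomorphism as
their limit. -/
lemma exists_limit_homeomorph {X : Type*} [MetricSpace X] [CompleteSpace X] (e : ℕ → (X ≃ₜ X))
    {C : ℝ} (h : ∀ k x, dist (e k x) (e (k + 1) x) ≤ C / 2 / 2 ^ k)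
    (h' : ∀ k x, dist ((e k).symm x) ((e (k + 1)).symm x) ≤ C / 2 / 2 ^ k) :
    ∃ Φ : X ≃ₜ X, (∀ k x, dist (e k x) (Φ x) ≤ C / 2 ^ k) ∧
      ∀ k x, dist ((e k).symm x) (Φ.symm x) ≤ C / 2 ^ k := by
  have key : ∀ f : ℕ → X → X, (∀ k, Continuous (f k)) →
      (∀ k x, dist (f k x) (f (k + 1) x) ≤ C / 2 / 2 ^ k) →
      ∃ F : X → X, Continuous F ∧ TendstoUniformly f F atTop ∧
        ∀ k x, dist (f k x) (F x) ≤ C / 2 ^ k := by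
    intro f hf hd
    choose F hF using fun x =>
      cauchySeq_tendsto_of_complete (cauchySeq_of_le_geometric_two (fun k => hd k x))
    have hle : ∀ k x, dist (f k x) (F x) ≤ C / 2 ^ k := fun k x =>
      dist_le_of_le_geometric_two_of_tendsto (fun k => hd k x) (hF x) k
    have hunif : TendstoUniformly f F atTop := by
      rw [Metric.tendstoUniformly_iff]
      intro ε hε
      have : Tendsto (fun k : ℕ => C / 2 ^ k) atTop (𝓝 0) :=
        tendsto_const_nhds.div_atTop (tendsto_pow_atTop_atTop_of_one_lt (by norm_num))
      filter_upwards [this.eventually_lt_const hε] with k hk x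
      rw [dist_comm]
      exact (hle k x).trans_lt hk
    exact ⟨F, hunif.continuous (Frequently.of_forall hf), hunif, hle⟩
  obtain ⟨F, hFc, hFu, hF⟩ := key (fun k => e k) (fun k => (e k).continuous) h
  obtain ⟨G, hGc, hGu, hG⟩ := key (fun k => (e k).symm) (fun k => (e k).symm.continuous) h'
  refine ⟨⟨⟨F, G, fun x => ?_, fun x => ?_⟩, hFc, hGc⟩, hF, hG⟩
  · have := hGu.tendsto_comp hGc.continuousAt (hFu.tendsto_at x)
    simp only [Homeomorph.symm_apply_apply] at this
    exact tendsto_nhds_unique this tendsto_const_nhds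
  · have := hFu.tendsto_comp hFc.continuousAt (hGu.tendsto_at x)
    simp only [Homeomorph.apply_symm_apply] at this
    exact tendsto_nhds_unique this tendsto_const_nhds

/-- A pointwise limit of continuous measure preserving maps is measure preserving. -/
lemma measurePreserving_of_tendsto {X : Type*} [MetricSpace X] [MeasurableSpace X] [BorelSpace X]
    {μ : Measure X} [IsFiniteMeasure μ] {f : ℕ → X → X} {F : X → X} (hF : Continuous F)
    (hf : ∀ k, MeasurePreserving (f k) μ μ)
    (h : ∀ x, Tendsto (fun k => f k x) atTop (𝓝 (F x))) : MeasurePreserving F μ μ := by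
  refine ⟨hF.measurable, ?_⟩
  have := (Measure.isFiniteMeasure_map μ F)
  refine ext_of_forall_integral_eq_of_IsFiniteMeasure fun g => ?_
  rw [integral_map hF.measurable.aemeasurable g.continuous.aestronglyMeasurable]
  have h1 : Tendsto (fun k => ∫ x, g (f k x) ∂μ) atTop (𝓝 (∫ x, g (F x) ∂μ)) := by
    refine tendsto_integral_of_dominated_convergence (fun _ => ‖g‖)
      (fun k => (g.continuous.measurable.comp (hf k).measurable).aestronglyMeasurable)
      (integrable_const _) (fun k => ae_of_all _ fun x => g.norm_coe_le_norm _)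
      (ae_of_all _ fun x => (g.continuous.tendsto _).comp (h x))
  have h2 : ∀ k, ∫ x, g (f k x) ∂μ = ∫ x, g x ∂μ := fun k => by
    rw [← integral_map (hf k).measurable.aemeasurable g.continuous.aestronglyMeasurable,
      (hf k).map_eq]
  simp_rw [h2] at h1
  exact tendsto_nhds_unique h1 tendsto_const_nhds

/-- The homeomorphism `e` exchanges the cubes of generation `k` rigidly. -/
def TranslatesCubes (k : ℕ) (e : Space n ≃ₜ Space n) : Prop :=
  ∃ m, edge k / 2 < m ∧ ∀ (w : Address n k) (x : Space n),
    (∀ l, |x l - cubeCenter w l| ≤ m) → e x = x + (cubeCenter (swapAddress w) - cubeCenter w)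

/-- The homeomorphism `e` is the identity in a neighborhood of the complement of the open unit
cube. -/
def FixesOutside (e : Space n ≃ₜ Space n) : Prop :=
  ∃ δ > 0, ∀ x : Space n, (∃ l, 1 / 2 - δ ≤ |x l - 1 / 2|) → e x = x

lemma FixesOutside.trans {e f : Space n ≃ₜ Space n} (he : FixesOutside e)
    (hf : FixesOutside f) : FixesOutside (e.trans f) := by
  obtain ⟨δ, hδ, h⟩ := he
  obtain ⟨δ', hδ', h'⟩ := hf
  refine ⟨min δ δ', lt_min hδ hδ', ?_⟩
  rintro x ⟨l, hl⟩
  have h1 := min_le_left δ δ'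
  have h2 := min_le_right δ δ'
  rw [Homeomorph.trans_apply, h x ⟨l, by linarith⟩, h' x ⟨l, by linarith⟩]

lemma TranslatesCubes.apply_of_mem {e : Space n ≃ₜ Space n} (he : TranslatesCubes k e)
    {w : Address n k} {x : Space n} (hx : x ∈ genCube w) :
    e x = x + (cubeCenter (swapAddress w) - cubeCenter w) := by
  obtain ⟨m, hm, h⟩ := he
  exact h w x fun l => (hx l).trans hm.le

lemma TranslatesCubes.mem {e : Space n ≃ₜ Space n} (he : TranslatesCubes k e)
    {w : Address n k} {x : Space n} (hx : x ∈ genCube w) : e x ∈ genCube (swapAddress w) := by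
  rw [he.apply_of_mem hx]
  intro l
  have := hx l
  simp only [PiLp.add_apply, PiLp.sub_apply]
  convert this using 2
  ring

/-- Precomposing with `σ` keeps the change inside the cubes of generation `k`, where `Ψ k` is a
translation; the translation vectors for the last letter and for the earlier letters add up. -/
lemma exists_approximation (hn : 2 ≤ n) : ∃ Ψ : ℕ → (Space n ≃ₜ Space n), ∀ k,
    IsVolumeDiffeo (Ψ k) ∧ FixesOutside (Ψ k) ∧ TranslatesCubes k (Ψ k) ∧
    ∃ σ : Space n ≃ₜ Space n, MovesCubes k σ ∧ Ψ (k + 1) = σ.trans (Ψ k) := by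
  let i : Fin n := ⟨0, by omega⟩
  let j : Fin n := ⟨n - 1, by omega⟩
  have hij : i ≠ j := by
    simp only [i, j, ne_eq, Fin.mk.injEq]
    omega
  have hj : (j : ℕ) + 1 = n := by
    simp only [j]
    omega
  choose σ hσ hσc hσm hσx using exists_exchange (n := n) hij hj
  let Ψ : ℕ → (Space n ≃ₜ Space n) := fun k =>
    Nat.rec (Homeomorph.refl _) (fun k e => (σ k).trans e) k
  have hsucc : ∀ k, Ψ (k + 1) = (σ k).trans (Ψ k) := fun k => rfl
  refine ⟨Ψ, fun k => ?_⟩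
  suffices h : IsVolumeDiffeo (Ψ k) ∧ FixesOutside (Ψ k) ∧ TranslatesCubes k (Ψ k) from
    ⟨h.1, h.2.1, h.2.2, σ k, hσc k, hsucc k⟩
  induction k with
  | zero =>
    refine ⟨.refl, ⟨1, one_pos, fun _ _ => rfl⟩, edge 0 / 2 + 1, by linarith, fun w x _ => ?_⟩
    rw [Subsingleton.elim (swapAddress w) w, sub_self, add_zero]
    rfl
  | succ k ih =>
    obtain ⟨h1, h2, h3⟩ := ih
    rw [hsucc]
    refine ⟨(hσ k).trans h1, FixesOutside.trans ?_ h2, ?_⟩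
    · obtain ⟨m, hm, h⟩ := hσm k
      refine ⟨edge k / 2 - m, by linarith, ?_⟩
      rintro x ⟨l, hl⟩
      refine h x fun w => ⟨l, ?_⟩
      have e1 := abs_cubeCenter_sub_half_le w l
      have e2 := abs_sub_le (x l) (cubeCenter w l) (1 / 2)
      linarith
    · obtain ⟨m, hm, hm', h⟩ := hσx k
      refine ⟨m, hm, fun u x hx => ?_⟩
      -- The bound `m ≤ edge k / 4` keeps the enlarged subcube inside its parent, so `Ψ k`
      -- translates it by the vector of the parent.
      have hxp : x ∈ genCube (parent u) := by
        intro l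
        have e1 := hx l
        have e2 := abs_cubeCenter_succ_sub u l
        have e3 := abs_sub_le (x l) (cubeCenter u l) (cubeCenter (parent u) l)
        linarith
      rw [Homeomorph.trans_apply, h3.apply_of_mem ((hσc k).mem _ x hxp), h u x hx]
      ext l
      simp only [PiLp.add_apply, PiLp.sub_apply, cubeCenter_flipLast, cubeCenter_swapAddress]
      split_ifs <;> ring

/-! ### The limit set -/

/-- The set of points that belong to cubes of all generations. -/
def limitSet (n : ℕ) : Set (Space n) := ⋂ k : ℕ, genUnion n k

lemma volume_genCube (w : Address n k) : volume (genCube w) = ENNReal.ofReal (edge k) ^ n := by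
  rw [← (PiLp.volume_preserving_toLp (Fin n)).measure_preimage
    (isClosed_genCube w).measurableSet.nullMeasurableSet]
  have : (WithLp.toLp 2 ⁻¹' genCube w : Set (Fin n → ℝ)) =
      Icc (fun l => cubeCenter w l - edge k / 2) (fun l => cubeCenter w l + edge k / 2) := by
    ext x
    simp only [genCube, mem_preimage, mem_ofPred_eq, mem_Icc, Pi.le_def, ← forall_and, abs_le]
    refine forall_congr' fun l => ?_
    constructor <;> rintro ⟨h1, h2⟩ <;> constructor <;> linarith
  rw [this, Real.volume_Icc_pi]
  simp [add_sub_sub_cancel]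

lemma volume_genUnion (n k : ℕ) :
    volume (genUnion n k) = ENNReal.ofReal (2 ^ k * edge k) ^ n := by
  rw [genUnion, measure_iUnion _ fun w => (isClosed_genCube w).measurableSet]
  · simp only [volume_genCube, tsum_fintype, Finset.sum_const, Finset.card_univ, nsmul_eq_mul]
    rw [ENNReal.ofReal_mul (by positivity), mul_pow, ENNReal.ofReal_pow (by norm_num)]
    simp [← pow_mul, mul_comm]
  · intro v w hvw
    exact disjoint_left.2 fun x hv hw => hvw (eq_of_mem_genCube hv hw)

lemma tendsto_two_pow_mul_edge : Tendsto (fun k => 2 ^ k * edge k) atTop (𝓝 2⁻¹) := by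
  have h1 : ∀ k, 2 ^ k * edge k = (2 - (1 / 2) ^ k)⁻¹ := fun k => by
    rw [edge, pow_succ, one_div, inv_pow, ← inv_inv ((2 : ℝ) ^ k), ← mul_inv, inv_inv]
    congr 1
    field_simp
  simp_rw [h1]
  have h2 : Tendsto (fun k : ℕ => ((1 : ℝ) / 2) ^ k) atTop (𝓝 0) :=
    tendsto_pow_atTop_nhds_zero_of_lt_one (by norm_num) (by norm_num)
  simpa using (tendsto_const_nhds.sub h2).inv₀ (by norm_num : (2 : ℝ) - 0 ≠ 0)

lemma volume_limitSet (n : ℕ) : volume (limitSet n) = (2 : ENNReal)⁻¹ ^ n := by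
  have h1 : Tendsto (fun k => volume (genUnion n k)) atTop (𝓝 (volume (limitSet n))) :=
    tendsto_measure_iInter_atTop
      (fun k => (isClosed_genUnion n k).measurableSet.nullMeasurableSet) genUnion_antitone
      ⟨0, by rw [volume_genUnion]; exact ENNReal.pow_ne_top ENNReal.ofReal_ne_top⟩
  refine tendsto_nhds_unique h1 ?_
  simp_rw [volume_genUnion]
  have h2 := (ENNReal.continuous_pow n).tendsto _ |>.comp
    (ENNReal.tendsto_ofReal tendsto_two_pow_mul_edge)
  rwa [ENNReal.ofReal_inv_of_pos two_pos, ENNReal.ofReal_ofNat] at h2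

lemma reflection_apply (x : Space n) (i : Fin n) :
    reflection n x i = if (i : ℕ) + 1 = n then 1 - x i else x i := rfl

lemma reflection_mem_genCube {w : Address n k} {x : Space n} (hx : x ∈ genCube w) :
    reflection n x ∈ genCube (swapAddress w) := by
  intro l
  have := hx l
  rw [reflection_apply, cubeCenter_swapAddress]
  split_ifs
  · rw [← abs_neg]
    convert this using 2
    ring
  · exact this

lemma reflection_mem_limitSet {x : Space n} (hx : x ∈ limitSet n) :
    reflection n x ∈ limitSet n := by
  refine mem_iInter.2 fun k => ?_
  obtain ⟨w, hw⟩ := mem_iUnion.1 (mem_iInter.1 hx k)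
  exact mem_iUnion.2 ⟨_, reflection_mem_genCube hw⟩

lemma reflection_reflection (x : Space n) : reflection n (reflection n x) = x := by
  ext l
  simp only [reflection_apply]
  split_ifs <;> ring

/-- Both maps carry the cube onto its partner. This identifies the limit on the limit set. -/
lemma dist_reflection_add_le {w : Address n k} {x : Space n} (hx : x ∈ genCube w) :
    dist (x + (cubeCenter (swapAddress w) - cubeCenter w)) (reflection n x) ≤ √n * edge k := by
  refine dist_le_of_coord fun l => ?_
  have := hx l
  rw [PiLp.add_apply, PiLp.sub_apply, reflection_apply, cubeCenter_swapAddress]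
  split_ifs
  · rw [show x l + (1 - cubeCenter w l - cubeCenter w l) - (1 - x l) =
      (x l - cubeCenter w l) + (x l - cubeCenter w l) by ring]
    refine (abs_add_le _ _).trans ?_
    linarith
  · rw [sub_self, add_zero, sub_self, abs_zero]
    exact (edge_pos k).le

/-! ### The unit cube -/

lemma unitCube_eq : unitCube n = {x : Space n | ∀ l, |x l - 1 / 2| ≤ 1 / 2} := by
  ext x
  refine forall_congr' fun l => ?_
  rw [abs_le, mem_Icc]
  constructor <;> rintro ⟨h1, h2⟩ <;> constructor <;> linarith

lemma unitCube_eq_genCube (w : Address n 0) : unitCube n = genCube w := by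
  rw [unitCube_eq]
  simp [genCube, cubeCenter_apply, edge_zero]

lemma isClosed_unitCube (n : ℕ) : IsClosed (unitCube n) := by
  rw [unitCube_eq_genCube Fin.elim0]
  exact isClosed_genCube _

lemma isCompact_unitCube (n : ℕ) : IsCompact (unitCube n) := by
  refine Metric.isCompact_of_isClosed_isBounded (isClosed_unitCube n) ?_
  rw [unitCube_eq_genCube Fin.elim0]
  exact Metric.isBounded_iff.2 ⟨_, fun x hx y hy => dist_le_of_mem_genCube hx hy⟩

lemma convex_unitCube (n : ℕ) : Convex ℝ (unitCube n) := by
  intro x hx y hy a b ha hb hab l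
  exact (convex_Icc (0 : ℝ) 1) (hx l) (hy l) ha hb hab

lemma mem_interior_unitCube {x : Space n} (hx : ∀ l, |x l - 1 / 2| < 1 / 2) :
    x ∈ interior (unitCube n) := by
  have hopen : IsOpen {x : Space n | ∀ l, |x l - 1 / 2| < 1 / 2} := by
    rw [show {x : Space n | ∀ l, |x l - 1 / 2| < 1 / 2} =
      ⋂ l, {x : Space n | |x l - 1 / 2| < 1 / 2} by ext; simp]
    exact isOpen_iInter_of_finite fun l => isOpen_lt
      ((contDiff_coord l).continuous.sub continuous_const).abs continuous_const
  refine interior_maximal (fun y hy => ?_) hopen hx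
  rw [unitCube_eq]
  exact fun l => (hy l).le

/-- The extreme value is `1 / 4 + 1 / 6 = 5 / 12`, below `7 / 16`. The margin puts the limit set in
the interior and makes the limit trivial near the boundary. -/
lemma abs_sub_half_lt_of_mem_genUnion {x : Space n} (hx : x ∈ genUnion n 1) (l : Fin n) :
    |x l - 1 / 2| < 1 / 2 - 1 / 16 := by
  obtain ⟨w, hw⟩ := mem_iUnion.1 hx
  have e1 := hw l
  have e2 := abs_cubeCenter_succ_sub w l
  have e3 := abs_sub_le (x l) (cubeCenter w l) (1 / 2)
  have e4 : edge 1 = 1 / 3 := by norm_num [edge]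
  have e5 : cubeCenter (parent w) l = 1 / 2 := by simp [cubeCenter_apply]
  rw [e5, edge_zero] at e2
  rw [e4] at e1
  linarith

lemma isCompact_limitSet (n : ℕ) : IsCompact (limitSet n) := by
  refine (isCompact_unitCube n).of_isClosed_subset
    (isClosed_iInter fun k => isClosed_genUnion n k) fun x hx => ?_
  obtain ⟨w, hw⟩ := mem_iUnion.1 (mem_iInter.1 hx 0)
  rwa [unitCube_eq_genCube w]

lemma limitSet_subset_interior (n : ℕ) : limitSet n ⊆ interior (unitCube n) := fun x hx =>
  mem_interior_unitCube fun l => by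
    have := abs_sub_half_lt_of_mem_genUnion (mem_iInter.1 hx 1) l
    linarith

lemma limitSet_subset (n : ℕ) : limitSet n ⊆ unitCube n :=
  (limitSet_subset_interior n).trans interior_subset

/-! ### Restriction to the cube -/

/-- The restriction to the cube of a homeomorphism that is the identity off the cube. -/
def restrictCube (e : Space n ≃ₜ Space n) (h : ∀ x ∉ unitCube n, e x = x) :
    unitCube n ≃ₜ unitCube n :=
  e.subtype fun x => by
    constructor
    · intro hx
      by_contra h'
      exact h' (by rwa [e.injective (h _ h')])
    · intro hx
      by_contra h'
      rw [h x h'] at hx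
      exact h' hx

lemma extendMap_restrictCube (e : Space n ≃ₜ Space n) (h : ∀ x ∉ unitCube n, e x = x) :
    extendMap (restrictCube e h) = e := by
  ext1 x
  by_cases hx : x ∈ unitCube n
  · exact Subtype.val_injective.extend_apply (fun x => ((restrictCube e h x : unitCube n) :
      Space n)) id ⟨x, hx⟩
  · rw [extendMap, Function.extend_apply', h x hx]
    · rfl
    · rintro ⟨y, rfl⟩
      exact hx y.2

lemma extendMap_restrictCube_symm (e : Space n ≃ₜ Space n) (h : ∀ x ∉ unitCube n, e x = x) :
    extendMap (restrictCube e h).symm = e.symm :=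
  extendMap_restrictCube e.symm fun x hx => by rw [Homeomorph.symm_apply_eq, h x hx]

lemma FixesOutside.eq_self {e : Space n ≃ₜ Space n} (he : FixesOutside e) :
    ∀ x ∉ unitCube n, e x = x := by
  obtain ⟨δ, hδ, h⟩ := he
  intro x hx
  rw [unitCube_eq] at hx
  simp only [mem_ofPred_eq] at hx
  push Not at hx
  obtain ⟨l, hl⟩ := hx
  exact h x ⟨l, by linarith⟩

lemma FixesOutside.isIdNearBoundary {e : Space n ≃ₜ Space n} (he : FixesOutside e) :
    IsIdNearBoundary (restrictCube e he.eq_self) := by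
  obtain ⟨δ, hδ, h⟩ := id he
  refine ⟨⋃ l, {x : Space n | 1 / 2 - δ < |x l - 1 / 2|}, isOpen_iUnion fun l => isOpen_lt
      continuous_const ((contDiff_coord l).continuous.sub continuous_const).abs, ?_, ?_⟩
  · intro x hx
    by_contra hcon
    simp only [mem_iUnion, not_exists, mem_ofPred_eq, not_lt] at hcon
    exact hx.2 (mem_interior_unitCube fun l => by linarith [hcon l])
  · rintro x ⟨hx, -⟩
    obtain ⟨l, hl⟩ := mem_iUnion.1 hx
    rw [extendMap_restrictCube]
    exact h x ⟨l, le_of_lt hl⟩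

lemma cubeVolume_apply (S : Set (unitCube n)) :
    cubeVolume n S = volume (Subtype.val '' S) :=
  (MeasurableEmbedding.subtype_coe (isClosed_unitCube n).measurableSet).comap_apply _ _

instance isFiniteMeasure_cubeVolume : IsFiniteMeasure (cubeVolume n) :=
  ⟨by
    rw [cubeVolume_apply, image_univ, Subtype.range_coe]
    exact (isCompact_unitCube n).measure_lt_top⟩

lemma IsVolumeDiffeo.measurePreserving_restrictCube {e : Space n ≃ₜ Space n}
    (he : IsVolumeDiffeo e) (h : ∀ x ∉ unitCube n, e x = x) :
    MeasurePreserving (restrictCube e h) (cubeVolume n) (cubeVolume n) := by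
  refine ⟨(restrictCube e h).continuous.measurable, ?_⟩
  ext S hS
  rw [Measure.map_apply (restrictCube e h).continuous.measurable hS, cubeVolume_apply,
    cubeVolume_apply]
  have hmeas := (MeasurableEmbedding.subtype_coe
    (isClosed_unitCube n).measurableSet).measurableSet_image.2 hS
  rw [← he.measurePreserving.measure_preimage hmeas.nullMeasurableSet]
  congr 1
  ext x
  constructor
  · rintro ⟨y, hy, rfl⟩
    exact ⟨_, hy, rfl⟩
  · rintro ⟨y, hy, hyx⟩
    have hx : x ∈ unitCube n := by
      by_contra hx
      have := y.2
      rw [hyx, h x hx] at this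
      exact hx this
    refine ⟨⟨x, hx⟩, ?_, rfl⟩
    have : restrictCube e h ⟨x, hx⟩ = y := Subtype.ext hyx.symm
    rwa [mem_preimage, this]

/-- The image of a null set is its preimage under the inverse, which preserves measure as well. -/
lemma hasLusinN_of_measurePreserving (e : Space n ≃ₜ Space n) (h : ∀ x ∉ unitCube n, e x = x)
    (hm : MeasurePreserving (restrictCube e h) (cubeVolume n) (cubeVolume n)) :
    HasLusinN (restrictCube e h) := by
  intro N hN h0
  have hm' : MeasurePreserving (restrictCube e h).symm (cubeVolume n) (cubeVolume n) :=
    MeasurePreserving.symm (restrictCube e h).toMeasurableEquiv hm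
  have h1 : cubeVolume n (Subtype.val ⁻¹' N) = 0 := by
    rw [cubeVolume_apply]
    exact measure_mono_null (image_preimage_subset _ _) h0
  have h2 := hm'.quasiMeasurePreserving.preimage_null h1
  rw [cubeVolume_apply] at h2
  refine measure_mono_null ?_ h2
  rintro _ ⟨x, hx, rfl⟩
  refine ⟨restrictCube e h ⟨x, hN hx⟩, ?_, ?_⟩
  · rw [mem_preimage, Homeomorph.symm_apply_apply]
    exact hx
  · rw [extendMap_restrictCube]
    rfl

/-! ### Approximate derivatives -/

lemma isDensityPoint_of_mem_interior {E : Set (Space n)} {x : Space n} (hx : x ∈ interior E) :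
    IsDensityPoint E x := by
  obtain ⟨ε, hε, hball⟩ := Metric.mem_nhds_iff.1 (mem_interior_iff_mem_nhds.1 hx)
  refine tendsto_const_nhds.congr' ?_
  filter_upwards [Ioo_mem_nhdsGT hε] with r hr
  rw [inter_eq_right.2 ((Metric.ball_subset_ball hr.2.le).trans hball)]
  exact (ENNReal.div_self (Metric.measure_ball_pos volume x hr.1).ne'
    measure_ball_lt_top.ne).symm

/-- Besicovitch's density theorem uses closed balls; spheres of nonzero radius are null. -/
lemma ae_isDensityPoint (A : Set (Space n)) :
    ∀ᵐ x ∂(volume.restrict A), IsDensityPoint A x := by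
  filter_upwards [Besicovitch.ae_tendsto_measure_inter_div (volume : Measure (Space n)) A]
    with x hx
  refine hx.congr' ?_
  filter_upwards [self_mem_nhdsWithin] with r hr
  have hr0 : r ≠ 0 := (mem_Ioi.1 hr).ne'
  have hae : Metric.closedBall x r =ᵐ[volume] Metric.ball x r := by
    rw [← Metric.ball_union_sphere]
    exact union_ae_eq_left_of_ae_eq_empty
      (ae_eq_empty.2 (Measure.addHaar_sphere_of_ne_zero volume x hr0))
  rw [measure_congr hae, measure_congr ((ae_eq_refl A).inter hae)]

lemma mapHasApproxDerivAt_of_hasFDerivAt {f : unitCube n → unitCube n} {x : Space n}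
    {D : Space n →L[ℝ] Space n} (hx : x ∈ interior (unitCube n))
    (hD : HasFDerivAt (extendMap f) D x) : MapHasApproxDerivAt f x D := by
  intro i
  refine ⟨interior_subset hx, unitCube n, Subset.rfl, (isClosed_unitCube n).measurableSet,
    isDensityPoint_of_mem_interior hx, ?_⟩
  have h1 : HasFDerivAt (fun y => extendMap f y i)
      ((EuclideanSpace.proj i : Space n →L[ℝ] ℝ).comp D) x :=
    (EuclideanSpace.proj i : Space n →L[ℝ] ℝ).hasFDerivAt.comp x hD
  rw [hasFDerivAt_iff_tendsto] at h1
  refine (h1.mono_left nhdsWithin_le_nhds).congr fun y => ?_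
  rw [Real.norm_eq_abs, div_eq_inv_mul]

/-- Along `A` the map is affine with linear part `reflectionMatrix n`, so the difference quotient
vanishes identically there. -/
lemma mapHasApproxDerivAt_reflection {f : unitCube n → unitCube n} {A : Set (Space n)}
    (hA : A ⊆ unitCube n) (hAm : MeasurableSet A) (hf : ∀ x ∈ A, extendMap f x = reflection n x)
    {x : Space n} (hx : x ∈ A) (hd : IsDensityPoint A x) :
    MapHasApproxDerivAt f x (Matrix.toEuclideanCLM (𝕜 := ℝ) (reflectionMatrix n)) := by
  intro i
  refine ⟨hA hx, A, hA, hAm, hd, ?_⟩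
  refine tendsto_const_nhds.congr' ?_
  filter_upwards [self_mem_nhdsWithin] with y hy
  have h1 : (Matrix.toEuclideanCLM (𝕜 := ℝ) (reflectionMatrix n) (y - x)) i =
      reflection n y i - reflection n x i := by
    rw [Matrix.ofLp_toEuclideanCLM, reflectionMatrix, Matrix.mulVec_diagonal, reflection_apply,
      reflection_apply, PiLp.sub_apply]
    split_ifs <;> ring
  have h2 : ((EuclideanSpace.proj i : Space n →L[ℝ] ℝ).comp
      (Matrix.toEuclideanCLM (𝕜 := ℝ) (reflectionMatrix n))) (y - x) =
      reflection n y i - reflection n x i := h1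
  rw [hf x hx, hf y hy.1, h2, sub_self, abs_zero, zero_div]

end CubeSwap

/-! ### Stabilization off the cubes and passage to the limit -/

namespace CubeSwap

variable {n : ℕ}

lemma eq_of_le_of_notMem {f : ℕ → Space n → Space n}
    (hf : ∀ k, ∀ x ∉ genUnion n k, f (k + 1) x = f k x) {k m : ℕ} (hkm : k ≤ m) {x : Space n}
    (hx : x ∉ genUnion n k) : f m x = f k x := by
  induction m, hkm using Nat.le_induction with
  | base => rfl
  | succ m hm ih => rw [hf m x fun h => hx (genUnion_antitone hm h), ih]

lemma eq_limit_of_notMem {f : ℕ → Space n → Space n} {F : Space n → Space n}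
    (hf : ∀ k, ∀ x ∉ genUnion n k, f (k + 1) x = f k x)
    (hF : ∀ x, Tendsto (fun k => f k x) atTop (𝓝 (F x))) {k : ℕ} {x : Space n}
    (hx : x ∉ genUnion n k) : F x = f k x := by
  refine tendsto_nhds_unique (hF x) (tendsto_const_nhds.congr' ?_)
  filter_upwards [eventually_ge_atTop k] with m hm
  exact (eq_of_le_of_notMem hf hm hx).symm

/-- A limit of smooth maps that stabilize off the cubes of generation `k` is smooth off the limit
set. -/
lemma contDiffAt_limit {f : ℕ → Space n → Space n} {F : Space n → Space n}
    (hf : ∀ k, ∀ x ∉ genUnion n k, f (k + 1) x = f k x)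
    (hF : ∀ x, Tendsto (fun k => f k x) atTop (𝓝 (F x))) (hs : ∀ k, ContDiff ℝ ∞ (f k))
    {x : Space n} (hx : x ∉ limitSet n) : ContDiffAt ℝ ∞ F x := by
  simp only [limitSet, mem_iInter, not_forall] at hx
  obtain ⟨k, hk⟩ := hx
  refine (hs k).contDiffAt.congr_of_eventuallyEq ?_
  filter_upwards [(isClosed_genUnion n k).isOpen_compl.mem_nhds hk] with y hy
  exact eq_limit_of_notMem hf hF hy

lemma tendsto_of_dist_le {C : ℝ} {f : ℕ → Space n} {y : Space n}
    (h : ∀ k, dist (f k) y ≤ C / 2 ^ k) : Tendsto f atTop (𝓝 y) := by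
  rw [tendsto_iff_dist_tendsto_zero]
  refine squeeze_zero (fun _ => dist_nonneg) h ?_
  exact tendsto_const_nhds.div_atTop (tendsto_pow_atTop_atTop_of_one_lt (by norm_num))

/-- `x` and `σ x` lie in one cube, on which `e` is an isometry, so the distance is just the
displacement by `σ`. -/
lemma TranslatesCubes.dist_trans_le {k : ℕ} {e σ : Space n ≃ₜ Space n}
    (he : TranslatesCubes k e) (hσ : MovesCubes k σ) (x : Space n) :
    dist (e x) ((σ.trans e) x) ≤ √n * edge k := by
  rw [dist_comm, Homeomorph.trans_apply]
  by_cases hx : x ∈ genUnion n k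
  · obtain ⟨w, hw⟩ := mem_iUnion.1 hx
    rw [he.apply_of_mem hw, he.apply_of_mem (hσ.mem w x hw), dist_add_right]
    exact hσ.dist_le x
  · rw [hσ.eq_self x hx, dist_self]
    have := edge_pos k
    positivity

lemma TranslatesCubes.symm_notMem {k : ℕ} {e : Space n ≃ₜ Space n} (he : TranslatesCubes k e)
    {x : Space n} (hx : x ∉ genUnion n k) : e.symm x ∉ genUnion n k := by
  intro h
  obtain ⟨w, hw⟩ := mem_iUnion.1 h
  have := he.mem hw
  rw [e.apply_symm_apply] at this
  exact hx (mem_iUnion.2 ⟨_, this⟩)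

lemma TranslatesCubes.swapsRigidly {k : ℕ} {e : Space n ≃ₜ Space n} (he : TranslatesCubes k e)
    (h : ∀ x ∉ unitCube n, e x = x) : SwapsRigidly (restrictCube e h) k := by
  obtain ⟨m, hm, hx⟩ := he
  intro w
  refine ⟨⋂ l, {x : Space n | |x l - cubeCenter w l| < m}, isOpen_iInter_of_finite fun l =>
    isOpen_lt ((contDiff_coord l).continuous.sub continuous_const).abs continuous_const, ?_, ?_⟩
  · exact fun x hx => mem_iInter.2 fun l => (hx l).trans_lt hm
  · rintro x ⟨hxU, -⟩
    rw [extendMap_restrictCube]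
    exact hx w x fun l => le_of_lt (mem_iInter.1 hxU l)

lemma tendsto_unifDist_restrictCube {C : ℝ} {e : ℕ → (Space n ≃ₜ Space n)}
    {Φ : Space n ≃ₜ Space n} (he : ∀ k, ∀ x ∉ unitCube n, e k x = x)
    (hΦ : ∀ x ∉ unitCube n, Φ x = x) (h : ∀ k x, dist (e k x) (Φ x) ≤ C / 2 ^ k)
    (h' : ∀ k x, dist ((e k).symm x) (Φ.symm x) ≤ C / 2 ^ k) :
    Tendsto (fun k => unifDist (restrictCube (e k) (he k)) (restrictCube Φ hΦ)) atTop (𝓝 0) := by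
  have hlim : Tendsto (fun k : ℕ => C / 2 ^ k + C / 2 ^ k) atTop (𝓝 0) := by
    have : Tendsto (fun k : ℕ => C / 2 ^ k) atTop (𝓝 0) :=
      tendsto_const_nhds.div_atTop (tendsto_pow_atTop_atTop_of_one_lt (by norm_num))
    simpa using this.add this
  refine squeeze_zero (fun k => add_nonneg (Real.iSup_nonneg fun _ => dist_nonneg)
    (Real.iSup_nonneg fun _ => dist_nonneg)) (fun k => add_le_add ?_ ?_) hlim
  · exact Real.iSup_le (fun x => h k x) (dist_nonneg.trans (h k 0))
  · exact Real.iSup_le (fun x => h' k x) (dist_nonneg.trans (h k 0))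

end CubeSwap

open CubeSwap in
theorem lemma3p4 (n : ℕ) (hn : 2 ≤ n) :
    ∃ (Φ : unitCube n ≃ₜ unitCube n) (A : Set (Space n)),
      MeasurePreserving Φ (cubeVolume n) (cubeVolume n) ∧
      (∀ᵐ x ∂(volume.restrict (unitCube n)), ∃ D, MapHasApproxDerivAt Φ x D) ∧
      HasLusinN Φ ∧
      IsCompact A ∧ A ⊆ interior (unitCube n) ∧
      IsIdNearBoundary Φ ∧
      volume A = (2 : ENNReal)⁻¹ ^ n ∧
      (∀ x ∈ A, extendMap Φ x = reflection n x) ∧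
      extendMap Φ '' A = A ∧
      IsSmoothDiffeoOn Φ (unitCube n \ A) ∧
      (∀ᵐ x ∂(volume.restrict A),
        MapHasApproxDerivAt Φ x (Matrix.toEuclideanCLM (𝕜 := ℝ) (reflectionMatrix n))) ∧
      A = ⋂ k : ℕ, genUnion n k ∧
      ∃ Φs : ℕ → (unitCube n ≃ₜ unitCube n),
        (∀ k, IsSmoothDiffeoOn (Φs k) (unitCube n) ∧
          MeasurePreserving (Φs k) (cubeVolume n) (cubeVolume n) ∧
          IsIdNearBoundary (Φs k) ∧
          SwapsRigidly (Φs k) k ∧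
          ∀ x ∈ unitCube n \ genUnion n k, extendMap Φ x = extendMap (Φs k) x) ∧
        Tendsto (fun k => unifDist (Φs k) Φ) atTop (𝓝 0) := by
  obtain ⟨Ψ, hΨ⟩ := exists_approximation hn
  choose hdiffeo hfix htrans σ hσ hsucc using hΨ
  have hCle : ∀ k, √n * edge k ≤ 2 * √n / 2 / 2 ^ k := fun k => by
    rw [mul_div_cancel_left₀ _ two_ne_zero, div_eq_mul_one_div]
    exact mul_le_mul_of_nonneg_left (edge_le k) (Real.sqrt_nonneg _)
  obtain ⟨Φ, hΦ, hΦ'⟩ := exists_limit_homeomorph Ψ (C := 2 * √n)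
    (fun k x => by
      rw [hsucc k]
      exact ((htrans k).dist_trans_le (hσ k) x).trans (hCle k))
    -- The inverse of `Ψ (k + 1)` is that of `Ψ k` followed by `σ⁻¹`, so the distance is the
    -- displacement by `σ⁻¹`.
    (fun k x => by
      rw [hsucc k, dist_comm]
      exact ((hσ k).symm.dist_le _).trans (hCle k))
  have hlim : ∀ x, Tendsto (fun k => Ψ k x) atTop (𝓝 (Φ x)) := fun x =>
    tendsto_of_dist_le fun k => hΦ k x
  have hlim' : ∀ x, Tendsto (fun k => (Ψ k).symm x) atTop (𝓝 (Φ.symm x)) := fun x =>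
    tendsto_of_dist_le fun k => hΦ' k x
  have hstep : ∀ k, ∀ x ∉ genUnion n k, Ψ (k + 1) x = Ψ k x := fun k x hx => by
    rw [hsucc k, Homeomorph.trans_apply, (hσ k).eq_self x hx]
  have hstep' : ∀ k, ∀ x ∉ genUnion n k, (Ψ (k + 1)).symm x = (Ψ k).symm x := fun k x hx => by
    rw [hsucc k]
    exact (hσ k).symm.eq_self _ ((htrans k).symm_notMem hx)
  have heq : ∀ k, ∀ x ∉ genUnion n k, Φ x = Ψ k x := fun k x hx =>
    eq_limit_of_notMem (f := fun k => Ψ k) hstep hlim hx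
  -- The cubes of generation `1` stay away from the boundary, and off them `Φ = Ψ 1`.
  have hfixΦ : FixesOutside Φ := by
    obtain ⟨δ, hδ, h⟩ := hfix 1
    refine ⟨min δ (1 / 16), by positivity, ?_⟩
    rintro x ⟨l, hl⟩
    have h1 := min_le_left δ (1 / 16)
    have h2 := min_le_right δ (1 / 16)
    rw [heq 1 x fun hx => ?_, h x ⟨l, by linarith⟩]
    have := abs_sub_half_lt_of_mem_genUnion hx l
    linarith
  have hrefl : ∀ x ∈ limitSet n, Φ x = reflection n x := by
    intro x hx
    refine tendsto_nhds_unique (hlim x) (tendsto_of_dist_le (C := √n) fun k => ?_)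
    obtain ⟨w, hw⟩ := mem_iUnion.1 (mem_iInter.1 hx k)
    rw [(htrans k).apply_of_mem hw, div_eq_mul_one_div]
    exact (dist_reflection_add_le hw).trans
      (mul_le_mul_of_nonneg_left (edge_le k) (Real.sqrt_nonneg _))
  have himage : Φ '' limitSet n = limitSet n := by
    refine Subset.antisymm ?_ fun x hx => ?_
    · rintro _ ⟨x, hx, rfl⟩
      rw [hrefl x hx]
      exact reflection_mem_limitSet hx
    · exact ⟨_, reflection_mem_limitSet hx, by
        rw [hrefl _ (reflection_mem_limitSet hx), reflection_reflection]⟩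
  have hsmooth : ∀ x ∉ limitSet n, ContDiffAt ℝ ∞ Φ x := fun x hx =>
    contDiffAt_limit (f := fun k => Ψ k) hstep hlim (fun k => (hdiffeo k).contDiff) hx
  have hsmooth' : ∀ x ∉ limitSet n, ContDiffAt ℝ ∞ Φ.symm x := fun x hx =>
    contDiffAt_limit (f := fun k => (Ψ k).symm) hstep' hlim'
      (fun k => (hdiffeo k).contDiff_symm) hx
  have hext := extendMap_restrictCube Φ hfixΦ.eq_self
  have hext' := extendMap_restrictCube_symm Φ hfixΦ.eq_self
  have hmeas : MeasurePreserving (restrictCube Φ hfixΦ.eq_self) (cubeVolume n) (cubeVolume n) :=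
    measurePreserving_of_tendsto (restrictCube Φ hfixΦ.eq_self).continuous
      (fun k => (hdiffeo k).measurePreserving_restrictCube (hfix k).eq_self)
      (fun x => tendsto_subtype_rng.2 (hlim x))
  have hAm : MeasurableSet (limitSet n) := (isCompact_limitSet n).measurableSet
  have hreflExt : ∀ x ∈ limitSet n,
      extendMap (restrictCube Φ hfixΦ.eq_self) x = reflection n x := by
    rw [hext]
    exact hrefl
  have happrox : ∀ᵐ x ∂(volume.restrict (limitSet n)),
      MapHasApproxDerivAt (restrictCube Φ hfixΦ.eq_self) x
        (Matrix.toEuclideanCLM (𝕜 := ℝ) (reflectionMatrix n)) := by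
    filter_upwards [ae_isDensityPoint (limitSet n), ae_restrict_mem hAm] with x hx hxA
    exact mapHasApproxDerivAt_reflection (limitSet_subset n) hAm hreflExt hxA hx
  refine ⟨restrictCube Φ hfixΦ.eq_self, limitSet n, hmeas, ?_,
    hasLusinN_of_measurePreserving Φ hfixΦ.eq_self hmeas, isCompact_limitSet n,
    limitSet_subset_interior n, hfixΦ.isIdNearBoundary, volume_limitSet n, hreflExt, ?_, ⟨?_, ?_⟩,
    happrox, rfl, fun k => restrictCube (Ψ k) (hfix k).eq_self, fun k => ⟨⟨?_, ?_⟩,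
      (hdiffeo k).measurePreserving_restrictCube (hfix k).eq_self, (hfix k).isIdNearBoundary,
      (htrans k).swapsRigidly (hfix k).eq_self, fun x hx => ?_⟩,
    tendsto_unifDist_restrictCube _ _ hΦ hΦ'⟩
  -- The frontier of the convex cube is null; elsewhere a point either is in `A`, almost surely a
  -- density point, or has a classical derivative.
  · have hfr : ∀ᵐ x ∂(volume : Measure (Space n)), x ∉ frontier (unitCube n) :=
      measure_eq_zero_iff_ae_notMem.1 ((convex_unitCube n).addHaar_frontier volume)
    rw [ae_restrict_iff' hAm] at happrox
    rw [ae_restrict_iff' (isClosed_unitCube n).measurableSet]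
    filter_upwards [hfr, happrox] with x hxf hxA hxQ
    by_cases hx : x ∈ limitSet n
    · exact ⟨_, hxA hx⟩
    · have hxi : x ∈ interior (unitCube n) := by
        by_contra h
        exact hxf ⟨subset_closure hxQ, h⟩
      refine ⟨fderiv ℝ Φ x, mapHasApproxDerivAt_of_hasFDerivAt hxi ?_⟩
      rw [hext]
      exact ((hsmooth x hx).differentiableAt (by simp)).hasFDerivAt
  · rw [hext, himage]
  · rw [hext]
    exact fun x hx => (hsmooth x hx.2).contDiffWithinAt
  · rw [hext, hext']
    rintro _ ⟨x, hx, rfl⟩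
    -- Since `Φ(A) = A`, points off `A` have images off `A`, where the inverse is smooth.
    refine (hsmooth' _ fun h => hx.2 ?_).contDiffWithinAt
    rw [← himage] at h
    exact (Φ.injective.mem_set_image).1 h
  · rw [extendMap_restrictCube]
    exact (hdiffeo k).contDiff.contDiffOn
  · rw [extendMap_restrictCube_symm]
    exact (hdiffeo k).contDiff_symm.contDiffOn
  · rw [hext, extendMap_restrictCube]
    exact heq k x hx.2
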